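/- A partial linear space consists of a non-empty set of points and a family of proper subsets, called lines, such that every line contains at least two points, every point lies on a line, and two distinct points lie on at most one common line; they are collinear if such a line exists (a point is regarded as collinear to itself). A subspace is a set of points containing the line joining any two distinct collinear points of it; it is singular if any two distinct points of it are collinear; $\langle X\rangle$ is the smallest subspace containing $X$. A polar space is a partial linear space in which every line has at least three points, no point is collinear to all points, every point is collinear to exactly one or to all points of any given line, and every chain of mutually distinct incident singular subspaces is finite. A thin polar space is one isomorphic to the geometry with point set $\{\pm1,\dots,\pm m\}$, for some $m$, whose lines are the pairs $\{i,j\}$ with $i\ne j$ and $j\neq -i$. Singular subspaces have their projective dimension ($\dim\emptyset=-1$, points have dimension $0$), and the rank is $n$ if the largest dimension of a singular subspace is $n-1$. For a polar space (or thin polar space) $\Pi$ of rank $n$ and $0\le k\le n-1$, the graph $\Gamma_k(\Pi)$ has as vertices the $k$-dimensional singular subspaces; for $k\le n-2$ two distinct vertices are adjacent if some $(k+1)$-dimensional singular subspace contains both, and for $k=n-1$ if their intersection is $(n-2)$-dimensional. A star of $k$-dimensional singular subspaces is a set $[S,U]_k$ of all $k$-dimensional singular subspaces $X$ with $S\subset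 X\subset U$, where $S\subset U$ are singular, $\dim S=k-1$ and $\dim U=n-1$. For a singular subspace $S$, $[S\rangle_k$ is the set of all $k$-dimensional singular subspaces containing $S$. For $\dim S=m$, $\Pi_S$ denotes the quotient geometry whose points are the elements of $[S\rangle_{m+1}$ and whose lines are the sets $[S,U]_{m+1}$ with $S\subset U$ and $\dim U=m+2$ (for $S=\emptyset$ this is $\Pi$). An $i$-dimensional singular subspace of $\Pi_S$ is identified with the $(m+1+i)$-dimensional singular subspace $V\supset S$ of $\Pi$ for which it equals $[S,V]_{m+1}$. Let $\Pi$ be a polar space or a thin polar space of rank $n$, let $\Pi'$ be a polar space of rank $n'$, let $1\le k\le n-3$ and $0\le k'\le n'-1$, and let $f$ be an isometric embedding of $\Gamma_k(\Pi)$ in $\Gamma_{k'}(\Pi')$, that is, an injection of vertex sets which preserves adjacency, non-adjacency and distance. Suppose that $f$ sends every star of $\Pi$ into some star of $\Pi'$. Then $$n-k\le n'-k'$$ and there is a $(k'-k-1)$-dimensional singular subspace $S$ of $\Pi'$ (in particular $k\le k'$) such that the image of $f$ is contained in $[S\rangle_{k'}$ and $f$ is induced by a collinearity preserving injection of $\Pi$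 to $\Pi'_S$: there is an injection $g$ from the points of $\Pi$ to the points of $\Pi'_S$ which sends collinear points to collinear points and non-collinear points to non-collinear points, such that for every $k$-dimensional singular subspace $X$ of $\Pi$ the span $\langle g(X)\rangle$ in $\Pi'_S$ is the $k$-dimensional singular subspace of $\Pi'_S$ identified with $f(X)$. -/

import Mathlib

/-- A point-line geometry on the point set `P`: a family of subsets of `P`, called lines. -/
structure PointLineGeometry (P : Type*) where
  /-- The family of lines. -/
  lines : Set (Set P)

namespace PointLineGeometry

variable {P : Type*} (G : PointLineGeometry P)

/-- The points `x` and `y` lie on a common line.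
When every point lies on some line, each point is collinear to itself. -/
def Collinear (x y : P) : Prop :=
  ∃ L ∈ G.lines, x ∈ L ∧ y ∈ L

/-- Partial linear spaces. -/
structure IsPartialLinearSpace : Prop where
  nonempty : Nonempty P
  line_ne_univ : ∀ L ∈ G.lines, L ≠ Set.univ
  line_nontrivial : ∀ L ∈ G.lines, L.Nontrivial
  exists_line : ∀ x : P, ∃ L ∈ G.lines, x ∈ L
  line_unique : ∀ x y : P, x ≠ y → ∀ L ∈ G.lines, ∀ M ∈ G.lines,
    x ∈ L → y ∈ L → x ∈ M → y ∈ M → L = M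

/-- A subspace contains the line joining any two distinct collinear points of it. -/
def IsSubspace (S : Set P) : Prop :=
  ∀ L ∈ G.lines, ∀ x ∈ L, ∀ y ∈ L, x ≠ y → x ∈ S → y ∈ S → L ⊆ S

/-- A singular subspace is a subspace whose distinct points are mutually collinear. -/
def IsSingular (S : Set P) : Prop :=
  G.IsSubspace S ∧ ∀ x ∈ S, ∀ y ∈ S, x ≠ y → G.Collinear x y

/-- The subspace `⟨X⟩` spanned by `X`: the smallest subspace containing `X`. -/
def span (X : Set P) : Set P :=
  ⋂₀ {S | G.IsSubspace S ∧ X ⊆ S}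

/-- The axioms of a polar space. -/
structure IsPolarSpace : Prop extends G.IsPartialLinearSpace where
  three_points : ∀ L ∈ G.lines, ∃ x ∈ L, ∃ y ∈ L, ∃ z ∈ L, x ≠ y ∧ y ≠ z ∧ x ≠ z
  no_radical : ¬ ∃ x : P, ∀ y : P, G.Collinear x y
  one_or_all : ∀ x : P, ∀ L ∈ G.lines,
    (∃! y, y ∈ L ∧ G.Collinear x y) ∨ ∀ y ∈ L, G.Collinear x y
  finite_chains : ∀ C : Set (Set P), (∀ S ∈ C, G.IsSingular S) →
    IsChain (· ⊆ ·) C → C.Finite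

/-- `G` is isomorphic to the geometry with point set `{±1, …, ±m}`, for some `m`, whose lines are
the pairs `{i, j}` with `i ≠ j` and `j ≠ -i`. Here `±i` is modelled by `(i, true)`, `(i, false)`. -/
def IsThinPolarSpace : Prop :=
  ∃ (m : ℕ) (e : P ≃ Fin m × Bool), ∀ L : Set P,
    L ∈ G.lines ↔ ∃ i j : Fin m × Bool, i ≠ j ∧ j ≠ (i.1, !i.2) ∧ e '' L = {i, j}

/-- `S` is a singular subspace of dimension `d`, i.e. the longest strictly increasing chains of
singular subspaces which end in `S` have `d + 1` steps. They start at the empty set, whose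
dimension is `-1`; points have dimension `0`. -/
def HasDim (S : Set P) (d : ℤ) : Prop :=
  ∃ h : G.IsSingular S, ∃ m : ℕ,
    Order.height (⟨S, h⟩ : {T : Set P // G.IsSingular T}) = (m : ℕ∞) ∧ d = (m : ℤ) - 1

/-- The rank is `n`: the largest dimension of a singular subspace is `n - 1`. -/
def HasRank (n : ℕ) : Prop :=
  IsGreatest {d : ℤ | ∃ S : Set P, G.HasDim S d} ((n : ℤ) - 1)

/-- The Grassmannian of the `k`-dimensional singular subspaces. -/
def Grassmannian (k : ℤ) : Type _ :=
  {X : Set P // G.HasDim X k}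

/-- The polar Grassmann graph `Γ_k` of a geometry of rank `n`. -/
def grassmannGraph (n k : ℕ) : SimpleGraph (G.Grassmannian k) where
  Adj X Y := X ≠ Y ∧
    ((k + 1 < n ∧ ∃ U : Set P, G.HasDim U ((k : ℤ) + 1) ∧ X.1 ⊆ U ∧ Y.1 ⊆ U) ∨
      (k + 1 = n ∧ G.HasDim (X.1 ∩ Y.1) ((k : ℤ) - 1)))
  symm := ⟨by
    rintro X Y ⟨hne, h⟩
    refine ⟨hne.symm, ?_⟩
    rcases h with ⟨hk, U, hU, hX, hY⟩ | ⟨hk, h⟩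
    · exact Or.inl ⟨hk, U, hU, hY, hX⟩
    · exact Or.inr ⟨hk, by rwa [Set.inter_comm]⟩⟩
  loopless := ⟨fun _ h => h.1 rfl⟩

/-- A star `[S, U]_k` in a geometry of rank `n`, where `dim S = k - 1` and `dim U = n - 1`. -/
def IsStar (n k : ℕ) (𝒳 : Set (G.Grassmannian k)) : Prop :=
  ∃ S U : Set P, G.HasDim S ((k : ℤ) - 1) ∧ G.HasDim U ((n : ℤ) - 1) ∧ S ⊆ U ∧
    𝒳 = {X | S ⊆ X.1 ∧ X.1 ⊆ U}

/-- The set `[S⟩_k` of all `k`-dimensional singular subspaces containing `S`. -/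
def bigStar (S : Set P) (k : ℤ) : Set (Set P) :=
  {X | G.HasDim X k ∧ S ⊆ X}

/-- The quotient geometry by a `(k - 1)`-dimensional singular subspace `S`. Its points are the
elements of `[S⟩_k` and its lines are the sets `[S, U]_k` with `S ⊆ U` and `dim U = k + 1`. -/
def quotient (S : Set P) (k : ℤ) : PointLineGeometry (G.bigStar S k) where
  lines := {ℓ | ∃ U : Set P, G.HasDim U (k + 1) ∧ S ⊆ U ∧ ℓ = {X | X.1 ⊆ U}}

/-- An injection sending collinear points to collinear points and non-collinear points to
non-collinear points. -/
def IsCollinearityPreservingInjection {Q : Type*} (H : PointLineGeometry Q) (g : P → Q) : Prop :=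
  Function.Injective g ∧ ∀ x y : P, x ≠ y → (G.Collinear x y ↔ H.Collinear (g x) (g y))

end PointLineGeometry

/- For a singular subspace `A` with `dim A ≤ k` let `F(A)` be the intersection of all `f(X)`, where
`X` runs through the `k`-dimensional singular subspaces containing `A`. The key point is that
`dim F(A) = k' - k + dim A`, by downward induction on `dim A`. If `A₁ ≠ A₂` have a common
hyperplane, then they lie in `k`-dimensional `X₁` and `X₂` which are so far apart in `Γ_k` that
`f(X₁)` and `f(X₂)` cannot share a subspace as large as `F(A₁)`; so `F(A₁) ≠ F(A₂)`, and when `A` is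
a hyperplane of both `X` and `Y`, the intersection `F(X) ∩ F(Y)` drops by one dimension. That this
intersection does not depend on `X` and `Y`, and hence equals `F(A)`, is the star condition for
`dim A = k - 1`. Below that, it follows by comparing the spans of pairs in a singular subspace of
dimension at least `dim A + 3`, which exists because `k ≤ n - 3`.

Then `S = F(∅)` and `g(p) = F({p})`. Points `p` and `q` are collinear if and only if `F({p})` and
`F({q})` are: one direction uses a star, the other that `f` reflects distances at most one. Spanning
the `F({p})` for `p` in a maximal singular subspace gives `n - k ≤ n' - k'`. -/

namespace PointLineGeometry

variable {P : Type*} {G : PointLineGeometry P}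

/-- The points collinear to every point of `A`, usually written `A^⊥`. -/
def perp (G : PointLineGeometry P) (A : Set P) : Set P :=
  {x | ∀ a ∈ A, G.Collinear x a}

/-- Nondegenerate Shult spaces whose singular subspaces satisfy the chain condition. Nothing is
required of the size of a line, so that polar spaces and thin polar spaces are both covered. -/
structure IsShultSpace (G : PointLineGeometry P) : Prop where
  collinear_self : ∀ x : P, G.Collinear x x
  no_radical : ∀ x : P, ∃ y : P, ¬ G.Collinear x y
  one_or_all : ∀ x : P, ∀ L ∈ G.lines,
    (∃! y, y ∈ L ∧ G.Collinear x y) ∨ ∀ y ∈ L, G.Collinear x y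
  finite_chains : ∀ C : Set (Set P), (∀ S ∈ C, G.IsSingular S) →
    IsChain (· ⊆ ·) C → C.Finite

theorem Collinear.symm {x y : P} (h : G.Collinear x y) : G.Collinear y x :=
  let ⟨L, hL, hx, hy⟩ := h
  ⟨L, hL, hy, hx⟩

section Subspaces

variable {A B S T : Set P} {p x y : P}

theorem mem_perp_singleton : x ∈ G.perp {y} ↔ G.Collinear x y := by
  simp only [perp, Set.mem_singleton_iff, forall_eq, Set.mem_ofPred_eq]

theorem mem_perp_insert : x ∈ G.perp (insert p T) ↔ G.Collinear x p ∧ x ∈ G.perp T := by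
  simp only [perp, Set.forall_mem_insert, Set.mem_ofPred_eq]

theorem perp_anti (h : A ⊆ B) : G.perp B ⊆ G.perp A :=
  fun _ hx a ha => hx a (h ha)

theorem subset_perp_comm : A ⊆ G.perp B ↔ B ⊆ G.perp A :=
  ⟨fun h _ hb _ ha => (h ha _ hb).symm, fun h _ ha _ hb => (h hb _ ha).symm⟩

theorem subset_perp_singleton : A ⊆ G.perp {x} ↔ x ∈ G.perp A :=
  subset_perp_comm.trans Set.singleton_subset_iff

theorem subset_span (A : Set P) : A ⊆ G.span A :=
  fun _ ha _ hS => hS.2 ha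

theorem span_subset (hS : G.IsSubspace S) (h : A ⊆ S) : G.span A ⊆ S :=
  fun _ hx => hx S ⟨hS, h⟩

theorem mem_span_insert (p : P) (A : Set P) : p ∈ G.span (insert p A) :=
  subset_span _ (Set.mem_insert p A)

theorem subset_span_insert (p : P) (A : Set P) : A ⊆ G.span (insert p A) :=
  (Set.subset_insert p A).trans (subset_span _)

theorem isSubspace_span (A : Set P) : G.IsSubspace (G.span A) :=
  fun L hL x hx y hy hxy hxS hyS _ hz S hS =>
    hS.1 L hL x hx y hy hxy (hxS S hS) (hyS S hS) hz

theorem span_mono (h : A ⊆ B) : G.span A ⊆ G.span B :=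
  span_subset (isSubspace_span B) (h.trans (subset_span B))

theorem IsSubspace.inter (hS : G.IsSubspace S) (hT : G.IsSubspace T) : G.IsSubspace (S ∩ T) :=
  fun L hL x hx y hy hxy hxS hyS => Set.subset_inter
    (hS L hL x hx y hy hxy hxS.1 hyS.1) (hT L hL x hx y hy hxy hxS.2 hyS.2)

theorem IsSubspace.span_eq (hS : G.IsSubspace S) : G.span S = S :=
  (span_subset hS subset_rfl).antisymm (subset_span S)

theorem IsSingular.inter (hS : G.IsSingular S) (hT : G.IsSubspace T) : G.IsSingular (S ∩ T) :=
  ⟨hS.1.inter hT, fun x hx y hy => hS.2 x hx.1 y hy.1⟩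

theorem isSingular_empty : G.IsSingular (∅ : Set P) :=
  ⟨fun _ _ _ _ _ _ _ h => h.elim, fun _ h => h.elim⟩

theorem isSingular_singleton (p : P) : G.IsSingular {p} :=
  ⟨fun _ _ _ _ _ _ hxy hx hy => (hxy (hx.trans hy.symm)).elim,
    fun _ hx _ hy hxy => (hxy (hx.trans hy.symm)).elim⟩

end Subspaces

namespace IsShultSpace

variable (hG : G.IsShultSpace) {A L Q R S T : Set P} {a b c p q t u v w x y z : P}
include hG

theorem collinear_of_mem_line (hL : L ∈ G.lines) (ha : a ∈ L) (hb : b ∈ L) (hab : a ≠ b)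
    (hxa : G.Collinear x a) (hxb : G.Collinear x b) (hc : c ∈ L) : G.Collinear x c :=
  (hG.one_or_all x L hL).elim
    (fun h => (hab (h.unique ⟨ha, hxa⟩ ⟨hb, hxb⟩)).elim) (fun h => h c hc)

theorem exists_line_collinear (hab : G.Collinear a b) (hxa : ¬ G.Collinear x a) :
    ∃ L ∈ G.lines, a ∈ L ∧ b ∈ L ∧ ∃ c ∈ L, c ≠ a ∧ G.Collinear x c := by
  obtain ⟨L, hL, ha, hb⟩ := hab
  rcases hG.one_or_all x L hL with ⟨c, ⟨hc, hxc⟩, -⟩ | h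
  · exact ⟨L, hL, ha, hb, c, hc, fun h => hxa (h ▸ hxc), hxc⟩
  · exact (hxa (h a ha)).elim

theorem isSubspace_perp (A : Set P) : G.IsSubspace (G.perp A) :=
  fun _ hL _ hx _ hy hxy hxA hyA _ hz a ha =>
    (hG.collinear_of_mem_line hL hx hy hxy (hxA a ha).symm (hyA a ha).symm hz).symm

theorem perp_span (A : Set P) : G.perp (G.span A) = G.perp A :=
  (perp_anti (subset_span A)).antisymm <| subset_perp_comm.1 <|
    span_subset (hG.isSubspace_perp _) (subset_perp_comm.1 subset_rfl)

theorem isSingular_iff : G.IsSingular S ↔ G.IsSubspace S ∧ S ⊆ G.perp S := by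
  refine and_congr_right fun _ => ⟨fun h x hx y hy => ?_, fun h x hx y hy _ => h hx y hy⟩
  rcases eq_or_ne x y with rfl | hxy
  · exact hG.collinear_self x
  · exact h x hx y hy hxy

theorem subset_perp (hS : G.IsSingular S) : S ⊆ G.perp S :=
  (hG.isSingular_iff.1 hS).2

theorem isSingular_span (h : A ⊆ G.perp A) : G.IsSingular (G.span A) :=
  hG.isSingular_iff.2 ⟨isSubspace_span A,
    (span_subset (hG.isSubspace_perp A) h).trans (hG.perp_span A).ge⟩

theorem insert_subset_perp_insert (hT : T ⊆ G.perp T) (hp : p ∈ G.perp T) :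
    insert p T ⊆ G.perp (insert p T) :=
  Set.insert_subset (mem_perp_insert.2 ⟨hG.collinear_self p, hp⟩)
    fun _ hx => mem_perp_insert.2 ⟨(hp _ hx).symm, hT hx⟩

theorem isSingular_span_insert (hT : G.IsSingular T) (hp : p ∈ G.perp T) :
    G.IsSingular (G.span (insert p T)) :=
  hG.isSingular_span (hG.insert_subset_perp_insert (hG.subset_perp hT) hp)

theorem isSingular_inter_perp (hS : G.IsSingular S) (A : Set P) : G.IsSingular (S ∩ G.perp A) :=
  hS.inter (hG.isSubspace_perp A)

theorem wellFoundedLT : WellFoundedLT {T : Set P // G.IsSingular T} := by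
  refine ⟨RelEmbedding.wellFounded_iff_isEmpty.2 ⟨fun e => ?_⟩⟩
  refine Set.infinite_range_of_injective (Subtype.val_injective.comp e.injective)
    (hG.finite_chains _ ?_ ?_)
  · rintro _ ⟨i, rfl⟩
    exact (e i).2
  · rintro _ ⟨i, rfl⟩ _ ⟨j, rfl⟩ hij
    rcases lt_trichotomy i j with h | rfl | h
    · exact Or.inr (e.map_rel_iff.2 h).le
    · exact (hij rfl).elim
    · exact Or.inl (e.map_rel_iff.2 h).le

theorem eq_of_inter_perp_singleton_subset (hS : G.IsSingular S) (hR : G.IsSubspace R) (hRS : R ⊆ S)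
    (h : S ∩ G.perp {z} ⊆ R) (hp : p ∈ R) (hzp : ¬ G.Collinear z p) : R = S := by
  refine hRS.antisymm fun s hs => ?_
  rcases eq_or_ne s p with rfl | hsp
  · exact hp
  obtain ⟨L, hL, hpL, hsL, c, hcL, hcp, hzc⟩ :=
    hG.exists_line_collinear (hG.subset_perp hS (hRS hp) s hs) hzp
  have hcS : c ∈ S := hS.1 L hL s hsL p hpL hsp hs (hRS hp) hcL
  exact hR L hL c hcL p hpL hcp (h ⟨hcS, mem_perp_singleton.2 hzc.symm⟩) hp hsL

theorem exists_mem_collinear_not_collinear (hQ : G.IsSubspace Q) (hv : v ∈ Q) (hy : y ∈ Q)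
    (hu : u ∈ Q) (htv : G.Collinear t v) (hvy : G.Collinear v y) (hty : ¬ G.Collinear t y)
    (huv : ¬ G.Collinear u v) : ∃ r ∈ Q, G.Collinear r t ∧ ¬ G.Collinear r v := by
  obtain ⟨L, hL, hvL, hyL, s, hsL, hsv, hus⟩ := hG.exists_line_collinear hvy huv
  have hts : ¬ G.Collinear t s :=
    fun hts => hty (hG.collinear_of_mem_line hL hvL hsL hsv.symm htv hts hyL)
  have hvs : G.Collinear v s := ⟨L, hL, hvL, hsL⟩
  have hsQ : s ∈ Q := hQ L hL v hvL y hyL (fun h => hty (h ▸ htv)) hv hy hsL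
  obtain ⟨M, hM, hsM, huM, r, hrM, hrs, htr⟩ := hG.exists_line_collinear hus.symm hts
  have hrQ : r ∈ Q := hQ M hM s hsM u huM (fun h => huv (h ▸ hvs.symm)) hsQ hu hrM
  exact ⟨r, hrQ, htr.symm, fun hrv =>
    huv (hG.collinear_of_mem_line hM hrM hsM hrs hrv.symm hvs huM).symm⟩

theorem exists_mem_perp_not_collinear (hT : G.IsSingular T) (hw : w ∉ T) :
    ∃ z ∈ G.perp T, ¬ G.Collinear z w := by
  have := hG.wellFoundedLT
  lift T to {T // G.IsSingular T} using hT
  induction T using WellFoundedLT.induction generalizing w with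
  | ind T ih =>
  obtain ⟨T, hT⟩ := T
  by_contra! hTw
  change w ∉ T at hw
  obtain ⟨y, hwy⟩ := hG.no_radical w
  obtain ⟨t, ht, hyt⟩ : ∃ t ∈ T, ¬ G.Collinear y t := by
    by_contra! hyT
    exact hwy (hTw y hyT).symm
  have htw : G.Collinear t w := hTw t (hG.subset_perp hT ht)
  obtain ⟨L, hL, htL, hwL, v, hvL, hvt, hyv⟩ := hG.exists_line_collinear htw hyt
  have hvT : v ∉ T := fun h => hw (hT.1 L hL t htL v hvL hvt.symm ht h hwL)
  let T' := T ∩ G.perp {y}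
  have hT' : G.IsSingular T' := hG.isSingular_inter_perp hT _
  have hT'T : T' ⊂ T :=
    ⟨Set.inter_subset_left, fun h => hyt (mem_perp_singleton.1 (h ht).2).symm⟩
  have hspan : G.span (insert t T') = T :=
    hG.eq_of_inter_perp_singleton_subset hT (isSubspace_span _)
      (span_subset hT.1 (Set.insert_subset ht Set.inter_subset_left))
      (subset_span_insert t T') (mem_span_insert t T') hyt
  obtain ⟨u, hu, huv⟩ := ih ⟨T', hT'⟩ hT'T (fun h => hvT h.1)
  have hvT' : v ∈ G.perp T' := fun x hx =>
    (hG.collinear_of_mem_line hL htL hwL (ne_of_mem_of_not_mem ht hw)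
      (hG.subset_perp hT hx.1 t ht) (hTw x (hG.subset_perp hT hx.1)) hvL).symm
  have hyT' : y ∈ G.perp T' := subset_perp_singleton.1 Set.inter_subset_right
  obtain ⟨r, hr, hrt, hrv⟩ := hG.exists_mem_collinear_not_collinear (hG.isSubspace_perp T')
    hvT' hyT' hu ⟨L, hL, htL, hvL⟩ hyv.symm (fun h => hyt h.symm) huv
  have hrT : r ∈ G.perp T := by
    rw [← hspan, hG.perp_span]
    exact mem_perp_insert.2 ⟨hrt, hr⟩
  exact hrv (hG.collinear_of_mem_line hL htL hwL (ne_of_mem_of_not_mem ht hw) hrt (hTw r hrT) hvL)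

theorem mem_of_mem_span_insert (hT : G.IsSingular T) (hp : p ∈ G.perp T) (hz : z ∈ G.perp T)
    (hzp : ¬ G.Collinear z p) (hq : q ∈ G.span (insert p T)) (hzq : G.Collinear z q) : q ∈ T := by
  by_contra hqT
  have hq' : q ∈ G.perp (insert p T) := by
    rw [← hG.perp_span]
    exact hG.subset_perp (hG.isSingular_span_insert hT hp) hq
  obtain ⟨hqp, hqT'⟩ := mem_perp_insert.1 hq'
  obtain ⟨u, hu, huq⟩ := hG.exists_mem_perp_not_collinear hT hqT
  obtain ⟨r, hr, hrp, hrq⟩ := hG.exists_mem_collinear_not_collinear (hG.isSubspace_perp T)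
    hqT' hz hu hqp.symm hzq.symm (fun h => hzp h.symm) huq
  have hr' : r ∈ G.perp (G.span (insert p T)) := by
    rw [hG.perp_span]
    exact mem_perp_insert.2 ⟨hrp, hr⟩
  exact hrq (hr' q hq)

end IsShultSpace

/-- `H` is a hyperplane of `S`: among the singular subspaces it is maximal in `S`. -/
structure IsHyperplane (G : PointLineGeometry P) (H S : Set P) : Prop where
  isSingular_left : G.IsSingular H
  isSingular : G.IsSingular S
  ssubset : H ⊂ S
  eq_or_eq : ∀ R, G.IsSubspace R → H ⊆ R → R ⊆ S → R = H ∨ R = S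

namespace IsHyperplane

variable {A H S X Y : Set P} {p : P}

theorem subset (h : G.IsHyperplane H S) : H ⊆ S :=
  h.ssubset.subset

theorem eq_span_insert (h : G.IsHyperplane H S) (hp : p ∈ S) (hpH : p ∉ H) :
    S = G.span (insert p H) := by
  rcases h.eq_or_eq _ (isSubspace_span _) (subset_span_insert p H)
    (span_subset h.isSingular.1 (Set.insert_subset hp h.subset)) with heq | heq
  · exact (hpH (heq ▸ mem_span_insert p H)).elim
  · exact heq.symm

theorem eq_of_subset (hX : G.IsHyperplane A X) (hY : G.IsHyperplane A Y) (h : X ⊆ Y) : X = Y :=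
  (hY.eq_or_eq X hX.isSingular.1 hX.subset h).resolve_left hX.ssubset.ne'

theorem inter_eq_of_ne (hX : G.IsHyperplane A X) (hY : G.IsHyperplane A Y) (hXY : X ≠ Y) :
    X ∩ Y = A :=
  (hX.eq_or_eq _ (hX.isSingular.1.inter hY.isSingular.1) (Set.subset_inter hX.subset hY.subset)
    Set.inter_subset_left).resolve_right
    fun h => hXY (hX.eq_of_subset hY (Set.inter_eq_left.1 h))

end IsHyperplane

namespace IsShultSpace

variable (hG : G.IsShultSpace) {A H R S T V X Y Z : Set P} {p s z : P}
include hG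

theorem perp_eq_inter_of_isHyperplane (h : G.IsHyperplane H S) (hp : p ∈ S) (hpH : p ∉ H) :
    G.perp S = G.perp H ∩ G.perp {p} := by
  rw [h.eq_span_insert hp hpH, hG.perp_span]
  ext x
  rw [mem_perp_insert, Set.mem_inter_iff, mem_perp_singleton, and_comm]

theorem isHyperplane_inter_perp (hS : G.IsSingular S) (hs : s ∈ S) (hzs : ¬ G.Collinear z s) :
    G.IsHyperplane (S ∩ G.perp {z}) S where
  isSingular_left := hG.isSingular_inter_perp hS _
  isSingular := hS
  ssubset := ⟨Set.inter_subset_left, fun h => hzs (mem_perp_singleton.1 (h hs).2).symm⟩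
  eq_or_eq R hR hHR hRS := by
    refine or_iff_not_imp_left.2 fun hne => ?_
    obtain ⟨p, hp, hpz⟩ := Set.exists_of_ssubset (hHR.ssubset_of_ne (Ne.symm hne))
    exact hG.eq_of_inter_perp_singleton_subset hS hR hRS hHR hp
      fun h => hpz ⟨hRS hp, mem_perp_singleton.2 h.symm⟩

theorem exists_isHyperplane_inter_perp (hS : G.IsSingular S) (hT : G.IsSingular T) (h : T ⊂ S) :
    ∃ z, T ⊆ S ∩ G.perp {z} ∧ G.IsHyperplane (S ∩ G.perp {z}) S := by
  obtain ⟨s, hs, hsT⟩ := Set.exists_of_ssubset h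
  obtain ⟨z, hz, hzs⟩ := hG.exists_mem_perp_not_collinear hT hsT
  exact ⟨z, Set.subset_inter h.1 (subset_perp_singleton.2 hz),
    hG.isHyperplane_inter_perp hS hs hzs⟩

theorem eq_inter_perp_of_isHyperplane (h : G.IsHyperplane H S) : ∃ z, H = S ∩ G.perp {z} := by
  obtain ⟨z, hHz, hz⟩ := hG.exists_isHyperplane_inter_perp h.isSingular h.isSingular_left h.ssubset
  exact ⟨z, ((h.eq_or_eq _ hz.isSingular_left.1 hHz hz.subset).resolve_right hz.ssubset.ne).symm⟩

theorem isHyperplane_inter (hX : G.IsHyperplane X S) (hY : G.IsHyperplane Y S) (hXY : X ≠ Y) :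
    G.IsHyperplane (X ∩ Y) X := by
  obtain ⟨z, rfl⟩ := hG.eq_inter_perp_of_isHyperplane hY
  obtain ⟨t, ht, hzt⟩ : ∃ t ∈ X, ¬ G.Collinear z t := by
    by_contra! h
    have hXz : X ⊆ S ∩ G.perp {z} :=
      Set.subset_inter hX.subset fun t ht => mem_perp_singleton.2 (h t ht).symm
    exact (hX.eq_or_eq _ hY.isSingular_left.1 hXz hY.subset).elim (hXY ·.symm) hY.ssubset.ne
  rw [← Set.inter_assoc, Set.inter_eq_left.2 hX.subset]
  exact hG.isHyperplane_inter_perp hX.isSingular_left ht hzt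

theorem isHyperplane_span_insert (hT : G.IsSingular T) (hp : p ∈ G.perp T) (hpT : p ∉ T) :
    G.IsHyperplane T (G.span (insert p T)) := by
  obtain ⟨z, hz, hzp⟩ := hG.exists_mem_perp_not_collinear hT hpT
  have hT_eq : G.span (insert p T) ∩ G.perp {z} = T := by
    refine Set.Subset.antisymm (fun q hq => ?_) (Set.subset_inter
      (subset_span_insert p T)
      (subset_perp_singleton.2 hz))
    exact hG.mem_of_mem_span_insert hT hp hz hzp hq.1 (mem_perp_singleton.1 hq.2).symm
  have h := hG.isHyperplane_inter_perp (hG.isSingular_span_insert hT hp)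
    (mem_span_insert p T) hzp
  rwa [hT_eq] at h

theorem isHyperplane_span_union (hX : G.IsHyperplane A X) (hY : G.IsHyperplane A Y) (hXY : X ≠ Y)
    (hV : G.IsSingular V) (hXV : X ⊆ V) (hYV : Y ⊆ V) : G.IsHyperplane X (G.span (X ∪ Y)) := by
  obtain ⟨y, hy, hyX⟩ := Set.not_subset.1 fun h => hXY (hY.eq_of_subset hX h).symm
  have hspan : G.span (X ∪ Y) = G.span (insert y X) := by
    refine (span_subset (isSubspace_span _) (Set.union_subset ?_ ?_)).antisymm
      (span_mono (Set.insert_subset (Or.inr hy) Set.subset_union_left))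
    · exact subset_span_insert y X
    · rw [hY.eq_span_insert hy fun h => hyX (hX.subset h)]
      exact span_mono (Set.insert_subset_insert hX.subset)
  rw [hspan]
  exact hG.isHyperplane_span_insert hX.isSingular
    (perp_anti hXV (hG.subset_perp hV (hYV hy))) hyX

theorem span_union_eq_of_subset (hX : G.IsHyperplane A X) (hY : G.IsHyperplane A Y)
    (hZ : G.IsHyperplane A Z) (hXY : X ≠ Y) (hXZ : X ≠ Z) (hV : G.IsSingular V) (hXV : X ⊆ V)
    (hYV : Y ⊆ V) (h : Z ⊆ G.span (X ∪ Y)) : G.span (X ∪ Z) = G.span (X ∪ Y) := by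
  have hJ := hG.isHyperplane_span_union hX hY hXY hV hXV hYV
  have hJ' := hG.isHyperplane_span_union hX hZ hXZ hJ.isSingular hJ.subset h
  exact hJ'.eq_of_subset hJ (span_subset (isSubspace_span _) (Set.union_subset hJ.subset h))

theorem induction_on_isHyperplane {C : Set P → Prop} (hA : G.IsSingular A) (base : C A)
    (step : ∀ H S, G.IsHyperplane H S → A ⊆ H → C H → C S) (hS : G.IsSingular S) (hAS : A ⊆ S) :
    C S := by
  have := hG.wellFoundedLT
  lift S to {T // G.IsSingular T} using hS
  induction S using WellFoundedLT.induction with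
  | ind S ih =>
  rcases hAS.eq_or_ssubset with h | h
  · exact h ▸ base
  · obtain ⟨z, hz, hH⟩ := hG.exists_isHyperplane_inter_perp S.2 hA h
    exact step _ _ hH hz (ih ⟨_, hH.isSingular_left⟩ hH.ssubset hz)

end IsShultSpace

open Classical in
/-- The projective dimension of a singular subspace, as an integer. The value for a set which is
not a singular subspace is the junk value `-1`. -/
noncomputable def dim (G : PointLineGeometry P) (S : Set P) : ℤ :=
  if h : G.IsSingular S then
    ((Order.height (⟨S, h⟩ : {T : Set P // G.IsSingular T})).toNat : ℤ) - 1 else -1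

theorem dim_eq {S : Set P} (hS : G.IsSingular S) : G.dim S =
    ((Order.height (⟨S, hS⟩ : {T : Set P // G.IsSingular T})).toNat : ℤ) - 1 :=
  dif_pos hS

theorem height_empty :
    Order.height (⟨∅, isSingular_empty⟩ : {T : Set P // G.IsSingular T}) = 0 :=
  Order.height_eq_zero.2 fun T _ => Set.empty_subset T.1

theorem dim_empty : G.dim (∅ : Set P) = -1 := by
  rw [dim_eq isSingular_empty, height_empty]
  rfl

namespace IsShultSpace

variable (hG : G.IsShultSpace) {A H N R S T : Set P} {d : ℤ} {p z : P}
include hG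

theorem height_eq_add_one (h : G.IsHyperplane H S) :
    Order.height (⟨S, h.isSingular⟩ : {T // G.IsSingular T}) =
      Order.height (⟨H, h.isSingular_left⟩ : {T // G.IsSingular T}) + 1 := by
  have := hG.wellFoundedLT
  obtain ⟨S', hS'⟩ : ∃ S' : {T // G.IsSingular T}, S'.1 = S := ⟨⟨S, h.isSingular⟩, rfl⟩
  induction S' using WellFoundedLT.induction generalizing H S with
  | ind S' ih =>
  subst hS'
  refine le_antisymm ?_ (Order.height_add_one_le h.ssubset)
  rw [Order.height_eq_iSup_lt_height]
  refine iSup₂_le fun T hT => ?_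
  obtain ⟨z, hTz, hz⟩ := hG.exists_isHyperplane_inter_perp S'.2 T.2 hT
  set K := S'.1 ∩ G.perp {z}
  have hTK : Order.height T ≤ Order.height (⟨K, hz.isSingular_left⟩ : {T // G.IsSingular T}) :=
    Order.height_mono hTz
  refine add_le_add_left (hTK.trans ?_) 1
  rcases eq_or_ne H K with hHK | hHK
  · simp only [hHK, le_refl]
  · rw [ih ⟨H, h.isSingular_left⟩ h.ssubset (hG.isHyperplane_inter h hz hHK) rfl,
      ih ⟨K, hz.isSingular_left⟩ hz.ssubset (hG.isHyperplane_inter hz h hHK.symm) rfl]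
    simp only [Set.inter_comm, le_refl]

theorem height_ne_top (hS : G.IsSingular S) :
    Order.height (⟨S, hS⟩ : {T // G.IsSingular T}) ≠ ⊤ := by
  refine hG.induction_on_isHyperplane
    (C := fun S => ∀ hS, Order.height (⟨S, hS⟩ : {T // G.IsSingular T}) ≠ ⊤)
    isSingular_empty (fun _ => ?_) (fun H S h _ ih hS => ?_) hS (Set.empty_subset S) hS
  · simp only [height_empty, ne_eq, ENat.zero_ne_top, not_false_eq_true]
  · rw [hG.height_eq_add_one h]
    exact WithTop.add_ne_top.2 ⟨ih _, ENat.one_ne_top⟩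

theorem hasDim_iff : G.HasDim S d ↔ G.IsSingular S ∧ G.dim S = d := by
  constructor
  · rintro ⟨h, m, hm, rfl⟩
    exact ⟨h, by rw [dim_eq h, hm, ENat.toNat_natCast]⟩
  · rintro ⟨h, rfl⟩
    exact ⟨h, _, (ENat.natCast_toNat (hG.height_ne_top h)).symm, dim_eq h⟩

theorem dim_eq_add_one (h : G.IsHyperplane H S) : G.dim S = G.dim H + 1 := by
  rw [dim_eq h.isSingular, dim_eq h.isSingular_left, hG.height_eq_add_one h,
    ENat.toNat_add (hG.height_ne_top _) ENat.one_ne_top]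
  simp only [ENat.toNat_one, Nat.cast_add, Nat.cast_one, add_sub_cancel_right, sub_add_cancel]

theorem dim_mono (hS : G.IsSingular S) (hT : G.IsSingular T) (h : T ⊆ S) : G.dim T ≤ G.dim S :=
  hG.induction_on_isHyperplane (C := fun S => G.dim T ≤ G.dim S) hT le_rfl
    (fun H S h _ ih => ih.trans (by rw [hG.dim_eq_add_one h]; omega)) hS h

theorem dim_lt_of_ssubset (hS : G.IsSingular S) (hT : G.IsSingular T) (h : T ⊂ S) :
    G.dim T < G.dim S := by
  obtain ⟨z, hTz, hz⟩ := hG.exists_isHyperplane_inter_perp hS hT h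
  have := hG.dim_mono hz.isSingular_left hT hTz
  have := hG.dim_eq_add_one hz
  omega

theorem eq_of_subset_of_dim_le (hS : G.IsSingular S) (hT : G.IsSingular T) (h : T ⊆ S)
    (hd : G.dim S ≤ G.dim T) : T = S :=
  h.eq_or_ssubset.resolve_right fun h => hd.not_gt (hG.dim_lt_of_ssubset hS hT h)

theorem isHyperplane_of_dim_eq (hS : G.IsSingular S) (hH : G.IsSingular H) (h : H ⊆ S)
    (hd : G.dim S = G.dim H + 1) : G.IsHyperplane H S where
  isSingular_left := hH
  isSingular := hS
  ssubset := h.ssubset_of_ne (by rintro rfl; omega)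
  eq_or_eq R hR hHR hRS := by
    have hR' : G.IsSingular R := Set.inter_eq_right.2 hRS ▸ hS.inter hR
    refine or_iff_not_imp_right.2 fun hne => ?_
    have := hG.dim_lt_of_ssubset hS hR' (hRS.ssubset_of_ne hne)
    exact (hG.eq_of_subset_of_dim_le hR' hH hHR (by omega)).symm

theorem dim_span_insert (hT : G.IsSingular T) (hp : p ∈ G.perp T) (hpT : p ∉ T) :
    G.dim (G.span (insert p T)) = G.dim T + 1 :=
  hG.dim_eq_add_one (hG.isHyperplane_span_insert hT hp hpT)

theorem dim_span_insert_le (hT : G.IsSingular T) (hp : p ∈ G.perp T) :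
    G.dim (G.span (insert p T)) ≤ G.dim T + 1 := by
  by_cases hpT : p ∈ T
  · rw [Set.insert_eq_of_mem hpT, hT.1.span_eq]
    omega
  · exact (hG.dim_span_insert hT hp hpT).le

theorem dim_singleton (p : P) : G.dim {p} = 0 := by
  have h := hG.dim_span_insert isSingular_empty (p := p) (fun _ h => h.elim) (Set.notMem_empty p)
  rwa [insert_empty_eq, (isSingular_singleton p).1.span_eq, dim_empty] at h

theorem le_dim_inter_perp_singleton (hS : G.IsSingular S) (z : P) :
    G.dim S - 1 ≤ G.dim (S ∩ G.perp {z}) := by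
  by_cases! h : ∃ s ∈ S, ¬ G.Collinear z s
  · obtain ⟨s, hs, hzs⟩ := h
    have := hG.dim_eq_add_one (hG.isHyperplane_inter_perp hS hs hzs)
    omega
  · rw [Set.inter_eq_left.2 fun s hs => mem_perp_singleton.2 (h s hs).symm]
    omega

theorem le_dim_inter_of_isHyperplane (h : G.IsHyperplane H S) (hR : G.IsSingular R) (hRS : R ⊆ S) :
    G.dim R - 1 ≤ G.dim (R ∩ H) := by
  obtain ⟨z, rfl⟩ := hG.eq_inter_perp_of_isHyperplane h
  rw [← Set.inter_assoc, Set.inter_eq_left.2 hRS]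
  exact hG.le_dim_inter_perp_singleton hR z

theorem exists_isHyperplane_ne (hS : G.IsSingular S) (hd : 1 ≤ G.dim S) :
    ∃ H K, G.IsHyperplane H S ∧ G.IsHyperplane K S ∧ H ≠ K := by
  have exists_superset {T : Set P} (hT : G.IsSingular T) (hTS : T ⊆ S) (hd : G.dim T < G.dim S) :
      ∃ H, T ⊆ H ∧ G.IsHyperplane H S := by
    obtain ⟨z, hz⟩ := hG.exists_isHyperplane_inter_perp hS hT
      (hTS.ssubset_of_ne (by rintro rfl; exact hd.false))
    exact ⟨_, hz⟩
  obtain ⟨H, -, hH⟩ := exists_superset isSingular_empty (Set.empty_subset S)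
    (by rw [dim_empty]; omega)
  obtain ⟨p, hp, hpH⟩ := Set.exists_of_ssubset hH.ssubset
  obtain ⟨K, hpK, hK⟩ := exists_superset (isSingular_singleton p) (Set.singleton_subset_iff.2 hp)
    (by rw [hG.dim_singleton]; omega)
  exact ⟨H, K, hH, hK, fun h => hpH (h ▸ hpK rfl)⟩

theorem exists_between (hS : G.IsSingular S) (hT : G.IsSingular T) (h : T ⊆ S)
    (hTd : G.dim T ≤ d) (hdS : d ≤ G.dim S) :
    ∃ R, G.IsSingular R ∧ T ⊆ R ∧ R ⊆ S ∧ G.dim R = d := by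
  refine hG.induction_on_isHyperplane (A := T)
    (C := fun S => d ≤ G.dim S → ∃ R, G.IsSingular R ∧ T ⊆ R ∧ R ⊆ S ∧ G.dim R = d)
    hT (fun hd => ⟨T, hT, subset_rfl, subset_rfl, hTd.antisymm hd⟩) ?_ hS h hdS
  intro H S hHS hTH ih hd
  rcases hd.eq_or_lt with rfl | hd
  · exact ⟨S, hHS.isSingular, hTH.trans hHS.subset, subset_rfl, rfl⟩
  · obtain ⟨R, hR, hTR, hRH, hdR⟩ := ih (by rw [hG.dim_eq_add_one hHS] at hd; omega)
    exact ⟨R, hR, hTR, hRH.trans hHS.subset, hdR⟩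

theorem le_dim_inter_perp (hA : G.IsSingular A) (hS : G.IsSingular S) (hN : G.IsSingular N)
    (hAS : A ⊆ S) (hAN : A ⊆ N) : G.dim N - (G.dim S - G.dim A) ≤ G.dim (N ∩ G.perp S) := by
  refine hG.induction_on_isHyperplane (A := A)
    (C := fun S => G.dim N - (G.dim S - G.dim A) ≤ G.dim (N ∩ G.perp S)) hA ?_ ?_ hS hAS
  · rw [Set.inter_eq_left.2 ((hG.subset_perp hN).trans (perp_anti hAN))]
    omega
  · intro H S h _ ih
    obtain ⟨p, hp, hpH⟩ := Set.exists_of_ssubset h.ssubset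
    have := hG.le_dim_inter_perp_singleton (hG.isSingular_inter_perp hN H) p
    rw [hG.perp_eq_inter_of_isHyperplane h hp hpH, ← Set.inter_assoc]
    have := hG.dim_eq_add_one h
    omega

theorem exists_mem_perp_of_dim_lt (hS : G.IsSingular S) (hN : G.IsSingular N)
    (hd : G.dim S < G.dim N) : ∃ p ∈ N, p ∈ G.perp S ∧ p ∉ S := by
  by_contra! h
  have hI : G.IsSingular (N ∩ S) := hN.inter hS.1
  have := hG.le_dim_inter_perp hI hS hN Set.inter_subset_right Set.inter_subset_left
  have := hG.dim_mono hI (hG.isSingular_inter_perp hN S) fun x hx => ⟨hx.1, h x hx.1 hx.2⟩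
  omega

section Rank

variable {n : ℕ} (hn : G.HasRank n)
include hn

theorem dim_le (hS : G.IsSingular S) : G.dim S ≤ n - 1 :=
  hn.2 ⟨S, hG.hasDim_iff.2 ⟨hS, rfl⟩⟩

theorem exists_maximal (hS : G.IsSingular S) :
    ∃ U, G.IsSingular U ∧ S ⊆ U ∧ G.dim U = n - 1 := by
  obtain ⟨N, hN⟩ := hn.1
  obtain ⟨hN, hdN⟩ := hG.hasDim_iff.1 hN
  obtain ⟨m, hm⟩ := Int.eq_ofNat_of_zero_le (sub_nonneg.2 (hG.dim_le hn hS))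
  induction m generalizing S with
  | zero => exact ⟨S, hS, subset_rfl, (sub_eq_zero.1 hm).symm⟩
  | succ m ih =>
    obtain ⟨p, -, hp, hpS⟩ := hG.exists_mem_perp_of_dim_lt hS hN (by omega)
    have hd := hG.dim_span_insert hS hp hpS
    obtain ⟨U, hU, hSU, hdU⟩ := ih (hG.isSingular_span_insert hS hp) (by omega)
    exact ⟨U, hU, (subset_span_insert p S).trans hSU, hdU⟩

end Rank

end IsShultSpace

namespace IsShultSpace

variable (hG : G.IsShultSpace) {A₁ A₂ B X Y : Set P}
include hG

theorem exists_superset_inter_perp_subset (hX : G.IsSingular X) (hY : G.IsSingular Y) :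
    ∃ Y', G.IsSingular Y' ∧ Y ⊆ Y' ∧ X ∩ G.perp Y' ⊆ Y ∧
      G.dim Y' = G.dim Y + G.dim (X ∩ G.perp Y) - G.dim (X ∩ Y) := by
  have hXY : X ∩ Y ⊆ X ∩ G.perp Y := Set.inter_subset_inter_right X (hG.subset_perp hY)
  obtain ⟨m, hm⟩ := Int.eq_ofNat_of_zero_le <| sub_nonneg.2 <|
    hG.dim_mono (hG.isSingular_inter_perp hX Y) (hX.inter hY.1) hXY
  induction m generalizing Y with
  | zero =>
    have h := hG.eq_of_subset_of_dim_le (hG.isSingular_inter_perp hX Y) (hX.inter hY.1) hXY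
      (by omega)
    exact ⟨Y, hY, subset_rfl, h.ge.trans Set.inter_subset_right, by omega⟩
  | succ m ih =>
    obtain ⟨a, ⟨haX, haY⟩, ha⟩ := Set.exists_of_ssubset
      (hXY.ssubset_of_ne fun h => by rw [h] at hm; omega)
    -- Adding `v` to `Y` cuts `X ∩ Y^⊥` down to a hyperplane without enlarging `X ∩ Y`.
    obtain ⟨v, hv, hva⟩ := hG.exists_mem_perp_not_collinear hY fun h => ha ⟨haX, h⟩
    have hvY : v ∉ Y := fun h => hva (haY v h).symm
    have hX_inter : X ∩ G.span (insert v Y) = X ∩ Y := by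
      refine (Set.subset_inter Set.inter_subset_left ?_).antisymm
        (Set.inter_subset_inter_right X (subset_span_insert v Y))
      exact fun q hq => hG.mem_of_mem_span_insert hY hv haY (fun h => hva h.symm) hq.2
        (hG.subset_perp hX haX q hq.1)
    have hX_inter_perp : X ∩ G.perp (G.span (insert v Y)) = X ∩ G.perp Y ∩ G.perp {v} := by
      rw [hG.perp_eq_inter_of_isHyperplane (hG.isHyperplane_span_insert hY hv hvY)
        (mem_span_insert v Y) hvY, Set.inter_assoc]
    have hdX := hG.dim_eq_add_one
      (hG.isHyperplane_inter_perp (hG.isSingular_inter_perp hX Y) ⟨haX, haY⟩ hva)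
    have hdY := hG.dim_span_insert hY hv hvY
    have hY₁ := hG.isSingular_span_insert hY hv
    obtain ⟨Y', hY', hYY', hXY', hd⟩ := ih hY₁
      (Set.inter_subset_inter_right X (hG.subset_perp hY₁))
      (by rw [hX_inter, hX_inter_perp]; omega)
    rw [hX_inter, hX_inter_perp] at hd
    refine ⟨Y', hY', (subset_span_insert v Y).trans hYY', fun q hq => ?_, by omega⟩
    exact (hX_inter.subset ⟨hq.1, hXY' hq⟩).2

theorem isSingular_grassmannian {k : ℤ} (X : G.Grassmannian k) : G.IsSingular X.1 :=
  (hG.hasDim_iff.1 X.2).1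

theorem dim_grassmannian {k : ℤ} (X : G.Grassmannian k) : G.dim X.1 = k :=
  (hG.hasDim_iff.1 X.2).2

variable {n : ℕ} (hn : G.HasRank n)
include hn

theorem exists_inter_perp_subset {k : ℤ} (h₁ : G.IsHyperplane B A₁) (h₂ : G.IsHyperplane B A₂)
    (hne : A₁ ≠ A₂) (hBk : G.dim B + 2 ≤ k) (hkn : k ≤ n - 1) :
    ∃ X₁ X₂ : G.Grassmannian k, A₁ ⊆ X₁.1 ∧ A₂ ⊆ X₂.1 ∧ X₁.1 ∩ G.perp X₂.1 ⊆ B := by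
  obtain ⟨a, ha, haA⟩ := Set.not_subset.1 fun h => hne (h₂.eq_of_subset h₁ h).symm
  have haB : a ∉ B := fun h => haA (h₁.subset h)
  obtain ⟨x, hx, hxa⟩ := hG.exists_mem_perp_not_collinear h₁.isSingular haA
  have hd₁ := hG.dim_eq_add_one h₁
  have hd₂ := hG.dim_eq_add_one h₂
  have hS := hG.isSingular_span_insert h₁.isSingular hx
  have hdS := hG.dim_span_insert_le h₁.isSingular hx
  obtain ⟨U, hU, hSU, hdU⟩ := hG.exists_maximal hn hS
  obtain ⟨X₁, hX₁, hSX, -, hdX₁⟩ := hG.exists_between hU hS hSU (d := k) (by omega) (by omega)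
  have hAX : A₁ ⊆ X₁ := (subset_span_insert x A₁).trans hSX
  have hxX : x ∈ X₁ := hSX (mem_span_insert x A₁)
  have hX₁B : X₁ ⊆ G.perp B := (hG.subset_perp hX₁).trans (perp_anti (h₁.subset.trans hAX))
  have haB' : a ∈ G.perp B := perp_anti h₂.subset (hG.subset_perp h₂.isSingular ha)
  have hX_inter : X₁ ∩ A₂ = B := by
    refine Set.Subset.antisymm (fun q hq => ?_) (Set.subset_inter (h₁.subset.trans hAX) h₂.subset)
    refine hG.mem_of_mem_span_insert h₁.isSingular_left haB' (hX₁B hxX) hxa ?_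
      (hG.subset_perp hX₁ hxX q hq.1)
    exact h₂.eq_span_insert ha haB ▸ hq.2
  have hX_inter_perp : X₁ ∩ G.perp A₂ = X₁ ∩ G.perp {a} := by
    rw [hG.perp_eq_inter_of_isHyperplane h₂ ha haB, ← Set.inter_assoc, Set.inter_eq_left.2 hX₁B]
  have hdX := hG.dim_eq_add_one (hG.isHyperplane_inter_perp hX₁ hxX fun h => hxa h.symm)
  obtain ⟨X₂, hX₂, hAX₂, hX₁₂, hdX₂⟩ := hG.exists_superset_inter_perp_subset hX₁ h₂.isSingular
  rw [hX_inter, hX_inter_perp] at hdX₂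
  exact ⟨⟨X₁, hG.hasDim_iff.2 ⟨hX₁, hdX₁⟩⟩, ⟨X₂, hG.hasDim_iff.2 ⟨hX₂, by omega⟩⟩, hAX, hAX₂,
    (Set.subset_inter Set.inter_subset_left hX₁₂).trans hX_inter.subset⟩

end IsShultSpace

namespace IsShultSpace

variable (hG : G.IsShultSpace) {n k : ℕ} (hn : G.HasRank n) (hk : k + 1 < n)
  {X Y : G.Grassmannian k} {A₁ A₂ B N : Set P}
include hG hk

theorem le_dim_inter_of_walk (w : (G.grassmannGraph n k).Walk X Y) :
    (k : ℤ) - w.length ≤ G.dim (X.1 ∩ Y.1) := by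
  induction w with
  | @nil Z =>
    rw [Set.inter_self, hG.dim_grassmannian, SimpleGraph.Walk.length_nil]
    omega
  | @cons X Z Y hXZ w ih =>
    obtain ⟨U, hU, hXU, hZU⟩ := hXZ.2.elim And.right fun h => absurd h.1 hk.ne
    obtain ⟨hU, hdU⟩ := hG.hasDim_iff.1 hU
    have hX := hG.isSingular_grassmannian X
    have hdX := hG.dim_grassmannian X
    have hZY := (hG.isSingular_grassmannian Z).inter (hG.isSingular_grassmannian Y).1
    have h₁ := hG.le_dim_inter_of_isHyperplane (hG.isHyperplane_of_dim_eq hU hX hXU (by omega))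
      hZY (Set.inter_subset_left.trans hZU)
    have h₂ := hG.dim_mono (hX.inter (hG.isSingular_grassmannian Y).1) (hZY.inter hX.1)
      fun x hx => ⟨hx.2, hx.1.2⟩
    rw [SimpleGraph.Walk.length_cons]
    omega

include hn

theorem edist_le_one_iff : (G.grassmannGraph n k).edist X Y ≤ 1 ↔
    ∃ U, G.IsSingular U ∧ G.dim U ≤ k + 1 ∧ X.1 ⊆ U ∧ Y.1 ⊆ U := by
  rw [SimpleGraph.edist_le_one_iff_adj_or_eq]
  constructor
  · rintro (⟨-, ⟨-, U, hU, hXU, hYU⟩ | ⟨hkn, -⟩⟩ | rfl)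
    · obtain ⟨hU, hdU⟩ := hG.hasDim_iff.1 hU
      exact ⟨U, hU, hdU.le, hXU, hYU⟩
    · omega
    · exact ⟨X.1, hG.isSingular_grassmannian X, by rw [hG.dim_grassmannian]; omega,
        subset_rfl, subset_rfl⟩
  · rintro ⟨U, hU, hdU, hXU, hYU⟩
    obtain ⟨V, hV, hUV, hdV⟩ := hG.exists_maximal hn hU
    obtain ⟨W, hW, hUW, -, hdW⟩ := hG.exists_between hV hU hUV (d := k + 1) hdU (by omega)
    exact or_iff_not_imp_right.2 fun hXY => ⟨hXY, Or.inl
      ⟨hk, W, hG.hasDim_iff.2 ⟨hW, hdW⟩, hXU.trans hUW, hYU.trans hUW⟩⟩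

theorem edist_le_of_le_dim_inter_superset {c : ℕ} (hN : G.IsSingular N) (hdN : G.dim N = k + 1)
    (hXN : X.1 ⊆ N) (hYN : (k : ℤ) - c ≤ G.dim (N ∩ Y.1)) :
    (G.grassmannGraph n k).edist X Y ≤ c + 1 := by
  have hY := hG.isSingular_grassmannian Y
  have hdY := hG.dim_grassmannian Y
  have hNY : G.IsSingular (N ∩ Y.1) := hN.inter hY.1
  induction c generalizing X N with
  | zero =>
    have h := hG.eq_of_subset_of_dim_le hY hNY Set.inter_subset_right (by push_cast at hYN; omega)
    simpa only [Nat.cast_zero, zero_add] using (hG.edist_le_one_iff hn hk).2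
      ⟨N, hN, hdN.le, hXN, Set.inter_eq_right.1 h⟩
  | succ c ih =>
    by_cases! hYN' : Y.1 ⊆ N
    · exact ((hG.edist_le_one_iff hn hk).2 ⟨N, hN, hdN.le, hXN, hYN'⟩).trans le_add_self
    obtain ⟨y, hy, hyN⟩ := Set.not_subset.1 hYN'
    have hyNY : y ∈ G.perp (N ∩ Y.1) := perp_anti Set.inter_subset_right (hG.subset_perp hY hy)
    have hdlt := (hG.dim_lt_of_ssubset hY hNY
      ⟨Set.inter_subset_right, fun h => hyN (h hy).1⟩).trans_eq hdY
    obtain ⟨Z, hZ, hNYZ, hZN, hdZ⟩ := hG.exists_between (d := k) (hG.isSingular_inter_perp hN {y})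
      hNY (Set.subset_inter Set.inter_subset_left (subset_perp_singleton.2 hyNY)) hdlt.le
      (by have := hG.le_dim_inter_perp_singleton hN y; omega)
    have hyZ : y ∈ G.perp Z := subset_perp_singleton.1 (hZN.trans Set.inter_subset_right)
    have hyZ' : y ∉ Z := fun h => hyN (hZN h).1
    have hM := hG.isSingular_span_insert hZ hyZ
    have hdMY : (k : ℤ) - c ≤ G.dim (G.span (insert y Z) ∩ Y.1) := by
      have hd := hG.dim_span_insert hNY hyNY fun h => hyN h.1
      have := hG.dim_mono (hM.inter hY.1) (hG.isSingular_span_insert hNY hyNY)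
        (Set.subset_inter (span_mono (Set.insert_subset_insert hNYZ))
          (span_subset hY.1 (Set.insert_subset hy Set.inter_subset_right)))
      push_cast at hYN
      omega
    let Z' : G.Grassmannian k := ⟨Z, hG.hasDim_iff.2 ⟨hZ, hdZ⟩⟩
    have hXZ : (G.grassmannGraph n k).edist X Z' ≤ 1 := (hG.edist_le_one_iff hn hk).2
      ⟨N, hN, hdN.le, hXN, hZN.trans Set.inter_subset_left⟩
    have hZY := ih (X := Z') hM (by rw [hG.dim_span_insert hZ hyZ hyZ', hdZ])
      (subset_span_insert y Z) hdMY (hM.inter hY.1)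
    rw [Nat.cast_succ, add_comm]
    exact SimpleGraph.edist_triangle.trans (add_le_add hXZ hZY)

theorem edist_le_of_le_dim {c : ℕ} (hB : G.IsSingular B) (hBX : B ⊆ X.1) (hBY : B ⊆ Y.1)
    (hd : (k : ℤ) - c ≤ G.dim B) : (G.grassmannGraph n k).edist X Y ≤ c + 1 := by
  have hX := hG.isSingular_grassmannian X
  have hdX := hG.dim_grassmannian X
  obtain ⟨U, hU, hXU, hdU⟩ := hG.exists_maximal hn hX
  obtain ⟨N, hN, hXN, -, hdN⟩ := hG.exists_between hU hX hXU (d := k + 1) (by omega) (by omega)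
  refine hG.edist_le_of_le_dim_inter_superset hn hk hN hdN hXN (hd.trans ?_)
  exact hG.dim_mono (hN.inter (hG.isSingular_grassmannian Y).1) hB
    (Set.subset_inter (hBX.trans hXN) hBY)

theorem lt_edist {r : ℕ} (hr : 1 ≤ r) (hXY : X.1 ∩ G.perp Y.1 ⊆ Y.1)
    (hd : G.dim (X.1 ∩ Y.1) ≤ (k : ℤ) - r) : r < (G.grassmannGraph n k).edist X Y := by
  by_contra! h
  rw [SimpleGraph.edist_comm] at h
  obtain ⟨w, hw⟩ := SimpleGraph.exists_walk_of_edist_ne_top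
    (ne_top_of_le_ne_top (ENat.natCast_ne_top r) h)
  rw [← hw, Nat.cast_le] at h
  cases w with
  | nil =>
    rw [Set.inter_self, hG.dim_grassmannian] at hd
    omega
  | @cons _ Z _ hYZ w =>
    obtain ⟨U, hU, hdU, hYU, hZU⟩ := (hG.edist_le_one_iff hn hk).1
      (SimpleGraph.edist_le_one_iff_adj_or_eq.2 (Or.inl hYZ))
    have hX := hG.isSingular_grassmannian X
    have hY := hG.isSingular_grassmannian Y
    have hZ := hG.isSingular_grassmannian Z
    have hZX : Z.1 ∩ X.1 ⊆ X.1 ∩ Y.1 := fun x hx =>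
      ⟨hx.2, hXY ⟨hx.2, perp_anti hYU (hG.subset_perp hU (hZU hx.1))⟩⟩
    have := hG.dim_mono (hX.inter hY.1) (hZ.inter hX.1) hZX
    have := hG.le_dim_inter_of_walk hk w
    rw [SimpleGraph.Walk.length_cons] at h
    omega

theorem exists_lt_edist {r : ℕ} (h₁ : G.IsHyperplane B A₁) (h₂ : G.IsHyperplane B A₂)
    (hne : A₁ ≠ A₂) (hr : 2 ≤ r) (hd : G.dim B = k - r) :
    ∃ X₁ X₂ : G.Grassmannian k, A₁ ⊆ X₁.1 ∧ A₂ ⊆ X₂.1 ∧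
      r < (G.grassmannGraph n k).edist X₁ X₂ := by
  obtain ⟨X₁, X₂, hAX₁, hAX₂, hB⟩ := hG.exists_inter_perp_subset hn (k := k) h₁ h₂ hne
    (by omega) (by omega)
  have hX₁ := hG.isSingular_grassmannian X₁
  have hX₂ := hG.isSingular_grassmannian X₂
  refine ⟨X₁, X₂, hAX₁, hAX₂, hG.lt_edist hn hk (by omega)
    (hB.trans (h₂.subset.trans hAX₂)) (hd ▸ ?_)⟩
  exact hG.dim_mono h₁.isSingular_left (hX₁.inter hX₂.1)
    ((Set.inter_subset_inter_right _ (hG.subset_perp hX₂)).trans hB)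

end IsShultSpace

namespace IsShultSpace

variable (hG : G.IsShultSpace) {α : Type*} {A S V X Y Z : Set P} {F : Set P → Set α}
include hG

theorem exists_isHyperplane_subset (hS : G.IsSingular S) (hA : G.IsSingular A) (hAS : A ⊂ S) :
    ∃ X, G.IsHyperplane A X ∧ X ⊆ S := by
  obtain ⟨x, hxS, hxA⟩ := Set.exists_of_ssubset hAS
  exact ⟨_, hG.isHyperplane_span_insert hA (perp_anti hAS.subset (hG.subset_perp hS hxS)) hxA,
    span_subset hS.1 (Set.insert_subset hxS hAS.subset)⟩

theorem exists_pair_isHyperplane (hS : G.IsSingular S) (hA : G.IsSingular A) (hAS : A ⊆ S)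
    (hd : G.dim A + 2 ≤ G.dim S) :
    ∃ X Y, G.IsHyperplane A X ∧ G.IsHyperplane A Y ∧ X ⊆ S ∧ Y ⊆ S ∧ X ≠ Y := by
  obtain ⟨X, hX, hXS⟩ := hG.exists_isHyperplane_subset hS hA
    (hAS.ssubset_of_ne (by rintro rfl; omega))
  have hdX := hG.dim_eq_add_one hX
  obtain ⟨y, hyS, hyX⟩ := Set.not_subset.1 fun h =>
    absurd (hG.dim_mono hX.isSingular hS h) (by omega)
  refine ⟨X, _, hX, hG.isHyperplane_span_insert hA (perp_anti hAS (hG.subset_perp hS hyS))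
    fun h => hyX (hX.subset h), hXS, span_subset hS.1 (Set.insert_subset hyS hAS), ?_⟩
  rintro rfl
  exact hyX (mem_span_insert y A)

variable (hF : ∀ V X Y Z, G.IsSingular V → X ⊆ V → Y ⊆ V → Z ⊆ V → G.IsHyperplane A X →
  G.IsHyperplane A Y → G.IsHyperplane A Z → X ≠ Y → ¬ Z ⊆ G.span (X ∪ Y) → F X ∩ F Y ⊆ F Z)
include hF

theorem inter_subset_of_subset_isSingular (hV : G.IsSingular V) (hd : G.dim A + 3 ≤ G.dim V)
    (hX : G.IsHyperplane A X) (hY : G.IsHyperplane A Y) (hZ : G.IsHyperplane A Z)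
    (hXV : X ⊆ V) (hYV : Y ⊆ V) (hZV : Z ⊆ V) (hXY : X ≠ Y) : F X ∩ F Y ⊆ F Z := by
  by_cases! hZXY : ¬ Z ⊆ G.span (X ∪ Y)
  · exact hF V X Y Z hV hXV hYV hZV hX hY hZ hXY hZXY
  obtain rfl | hXZ := eq_or_ne X Z
  · exact Set.inter_subset_left
  have hJ := hG.isHyperplane_span_union hX hY hXY hV hXV hYV
  have hXJ : X ⊆ G.span (X ∪ Y) := hJ.subset
  have hdX := hG.dim_eq_add_one hX
  have hdJ := hG.dim_eq_add_one hJ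
  obtain ⟨w, hwV, hw⟩ := Set.not_subset.1 fun h =>
    absurd (hG.dim_mono hJ.isSingular hV h) (by omega)
  let W := G.span (insert w A)
  have hwW : w ∈ W := mem_span_insert w A
  have hW : G.IsHyperplane A W := hG.isHyperplane_span_insert hX.isSingular_left
    (perp_anti (hX.subset.trans hXV) (hG.subset_perp hV hwV)) fun h => hw (hXJ (hX.subset h))
  have hWV : W ⊆ V := span_subset hV.1 (Set.insert_subset hwV (hX.subset.trans hXV))
  have hXW : X ≠ W := by
    intro h
    exact hw (hXJ (h ▸ hwW))
  have hZXW : ¬ Z ⊆ G.span (X ∪ W) := by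
    intro h
    have hXZJ := hG.span_union_eq_of_subset hX hW hZ hXW hXZ hV hXV hWV h
    have hwZ : w ∈ G.span (X ∪ Z) := hXZJ ▸ subset_span (X ∪ W) (Or.inr hwW)
    exact hw (span_subset (isSubspace_span _) (Set.union_subset hXJ hZXY) hwZ)
  have hFW := hF V X Y W hV hXV hYV hWV hX hY hW hXY fun h => hw (h hwW)
  exact (Set.subset_inter Set.inter_subset_left hFW).trans
    (hF V X W Z hV hXV hWV hZV hX hW hZ hXW hZXW)

theorem exists_inter_subset {n : ℕ} (hn : G.HasRank n) (hA : G.IsSingular A)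
    (hd : G.dim A + 4 ≤ n) :
    ∃ V X Y, G.IsSingular V ∧ X ⊆ V ∧ Y ⊆ V ∧ G.IsHyperplane A X ∧ G.IsHyperplane A Y ∧
      X ≠ Y ∧ ∀ Z, G.IsHyperplane A Z → F X ∩ F Y ⊆ F Z := by
  obtain ⟨U, hU, hAU, hdU⟩ := hG.exists_maximal hn hA
  obtain ⟨X, Y, hX, hY, hXU, hYU, hXY⟩ := hG.exists_pair_isHyperplane hU hA hAU (by omega)
  refine ⟨U, X, Y, hU, hXU, hYU, hX, hY, hXY, fun Z hZ => ?_⟩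
  have hFU {W} (hW : G.IsHyperplane A W) (hWU : W ⊆ U) : F X ∩ F Y ⊆ F W :=
    hG.inter_subset_of_subset_isSingular hF hU (by omega) hX hY hW hXU hYU hWU hXY
  obtain ⟨z, hzZ, hzA⟩ := Set.exists_of_ssubset hZ.ssubset
  have hzA' := hZ.eq_span_insert hzZ hzA
  by_cases hzU : z ∈ U
  · exact hFU hZ (hzA' ▸ span_subset hU.1 (Set.insert_subset hzU hAU))
  let N := U ∩ G.perp {z}
  have hN : G.IsSingular N := hG.isSingular_inter_perp hU {z}
  have hdN : G.dim U - 1 ≤ G.dim N := hG.le_dim_inter_perp_singleton hU z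
  have hAN : A ⊆ N := Set.subset_inter hAU (subset_perp_singleton.2
    (perp_anti hZ.subset (hG.subset_perp hZ.isSingular hzZ)))
  have hzN : z ∈ G.perp N := subset_perp_singleton.1 Set.inter_subset_right
  have hNV : N ⊆ G.span (insert z N) := subset_span_insert z N
  have hdV := hG.dim_span_insert hN hzN fun h => hzU h.1
  obtain ⟨X', Y', hX', hY', hXN, hYN, hXY'⟩ := hG.exists_pair_isHyperplane hN hA hAN (by omega)
  have hZV : Z ⊆ G.span (insert z N) := hzA' ▸ span_mono (Set.insert_subset_insert hAN)
  exact (Set.subset_inter (hFU hX' (hXN.trans Set.inter_subset_left))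
    (hFU hY' (hYN.trans Set.inter_subset_left))).trans
    (hG.inter_subset_of_subset_isSingular hF (hG.isSingular_span_insert hN hzN) (by omega)
      hX' hY' hZ (hXN.trans hNV) (hYN.trans hNV) hZV hXY')

end IsShultSpace

theorem IsPolarSpace.isShultSpace (hG : G.IsPolarSpace) : G.IsShultSpace where
  collinear_self x := let ⟨L, hL, hx⟩ := hG.exists_line x; ⟨L, hL, hx, hx⟩
  no_radical x := by
    by_contra! h
    exact hG.no_radical ⟨x, h⟩
  one_or_all := hG.one_or_all
  finite_chains := hG.finite_chains

theorem IsThinPolarSpace.exists_equiv (hG : G.IsThinPolarSpace) :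
    ∃ (m : ℕ) (e : P ≃ Fin m × Bool),
      ∀ L, L ∈ G.lines ↔ ∃ a b, (e a).1 ≠ (e b).1 ∧ L = {a, b} := by
  obtain ⟨m, e, he⟩ := hG
  have h_fst (i j : Fin m × Bool) : i ≠ j ∧ j ≠ (i.1, !i.2) ↔ i.1 ≠ j.1 := by
    obtain ⟨i, b⟩ := i
    obtain ⟨j, c⟩ := j
    cases b <;> cases c <;> simp [eq_comm]
  refine ⟨m, e, fun L => (he L).trans ⟨?_, ?_⟩⟩
  · rintro ⟨i, j, hij, hij', hL⟩
    refine ⟨e.symm i, e.symm j, ?_, by rw [← e.symm_image_image L, hL, Set.image_pair]⟩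
    simpa only [Equiv.apply_symm_apply] using (h_fst i j).1 ⟨hij, hij'⟩
  · rintro ⟨a, b, hab, rfl⟩
    obtain ⟨h, h'⟩ := (h_fst (e a) (e b)).2 hab
    exact ⟨e a, e b, h, h', Set.image_pair _ _ _⟩

theorem HasRank.lines_nonempty {n : ℕ} (hn : G.HasRank n) (h2 : 2 ≤ n) : G.lines.Nonempty := by
  obtain ⟨S, hS, r, hr, hnr⟩ := hn.1
  have hSr : ¬ Order.height (⟨S, hS⟩ : {T // G.IsSingular T}) ≤ (1 : ℕ) := by
    rw [hr, Nat.cast_le]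
    omega
  rw [Order.height_le_coe_iff] at hSr
  push Not at hSr
  obtain ⟨⟨T, hT⟩, hTS, hT1⟩ := hSr
  obtain ⟨y, hyS, hyT⟩ := Set.exists_of_ssubset (show T ⊂ S from hTS)
  obtain rfl | ⟨x, hxT⟩ := T.eq_empty_or_nonempty
  · rw [height_empty] at hT1
    exact absurd hT1 (by norm_num)
  · obtain ⟨L, hL, -⟩ := hS.2 x (hTS.le hxT) y hyS fun h => hyT (h ▸ hxT)
    exact ⟨L, hL⟩

theorem IsThinPolarSpace.exists_equiv_collinear_iff {n : ℕ} (hG : G.IsThinPolarSpace)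
    (hn : G.HasRank n) (h2 : 2 ≤ n) :
    ∃ (m : ℕ) (e : P ≃ Fin m × Bool), (∀ L ∈ G.lines, ∃ a b, (e a).1 ≠ (e b).1 ∧ L = {a, b}) ∧
      ∀ a b, G.Collinear a b ↔ a = b ∨ (e a).1 ≠ (e b).1 := by
  obtain ⟨m, e, he⟩ := hG.exists_equiv
  refine ⟨m, e, fun L => (he L).1, fun a b => ⟨?_, ?_⟩⟩
  · rintro ⟨L, hL, ha, hb⟩
    obtain ⟨c, d, hcd, rfl⟩ := (he L).1 hL
    obtain ⟨rfl | rfl, rfl | rfl⟩ := And.intro ha hb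
    exacts [Or.inl rfl, Or.inr hcd, Or.inr hcd.symm, Or.inl rfl]
  · have h_collinear {c d : P} (h : (e c).1 ≠ (e d).1) : G.Collinear c d :=
      ⟨{c, d}, (he _).2 ⟨c, d, h, rfl⟩, Or.inl rfl, Or.inr rfl⟩
    rintro (rfl | hab)
    · obtain ⟨L₀, hL₀⟩ := hn.lines_nonempty h2
      obtain ⟨c, d, hcd, -⟩ := (he L₀).1 hL₀
      obtain ⟨y, hy⟩ : ∃ y, (e a).1 ≠ (e y).1 := by
        by_contra! h
        exact hcd ((h c).symm.trans (h d))
      obtain ⟨L, hL, ha, -⟩ := h_collinear hy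
      exact ⟨L, hL, ha, ha⟩
    · exact h_collinear hab

theorem IsThinPolarSpace.isShultSpace {n : ℕ} (hG : G.IsThinPolarSpace) (hn : G.HasRank n)
    (h2 : 2 ≤ n) : G.IsShultSpace := by
  obtain ⟨m, e, h_lines, h_collinear⟩ := hG.exists_equiv_collinear_iff hn h2
  refine ⟨fun x => (h_collinear x x).2 (Or.inl rfl), fun x => ?_, fun x L hL => ?_, fun C _ _ => ?_⟩
  · refine ⟨e.symm ((e x).1, !(e x).2), fun h => ?_⟩
    rw [h_collinear, Equiv.eq_symm_apply, Equiv.apply_symm_apply] at h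
    simp [Prod.ext_iff] at h
  · have h_unique {a b : P} (hab : (e a).1 ≠ (e b).1) (ha : ¬ G.Collinear x a) :
        ∃! y, y ∈ ({a, b} : Set P) ∧ G.Collinear x y := by
      have hxa : (e x).1 = (e a).1 := not_not.1 fun h => ha ((h_collinear x a).2 (Or.inr h))
      refine ⟨b, ⟨Or.inr rfl, (h_collinear x b).2 (Or.inr (hxa ▸ hab))⟩, ?_⟩
      rintro y ⟨rfl | rfl, hy⟩
      exacts [absurd hy ha, rfl]
    obtain ⟨a, b, hab, rfl⟩ := h_lines L hL
    by_cases! h : G.Collinear x a ∧ G.Collinear x b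
    · exact Or.inr (by rintro y (rfl | rfl); exacts [h.1, h.2])
    · by_cases ha : G.Collinear x a
      · exact Or.inl (Set.pair_comm a b ▸ h_unique hab.symm (h ha))
      · exact Or.inl (h_unique hab ha)
  · have : Finite P := Finite.of_equiv _ e.symm
    exact Set.toFinite C

theorem IsShultSpace.exists_isSingular_of_mem_perp (hG : G.IsShultSpace) {b : P} {H S T : Set P}
    (hS : G.IsHyperplane H S) (hT : G.IsHyperplane H T) (hbT : b ∈ T) (hbH : b ∉ H)
    (hbS : b ∈ G.perp S) : ∃ N, G.IsSingular N ∧ G.dim N ≤ G.dim S + 1 ∧ S ⊆ N ∧ T ⊆ N :=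
  ⟨_, hG.isSingular_span_insert hS.isSingular hbS, hG.dim_span_insert_le hS.isSingular hbS,
    subset_span_insert b S,
    (hT.eq_span_insert hbT hbH).subset.trans (span_mono (Set.insert_subset_insert hS.subset))⟩

namespace IsShultSpace

variable {S V H₁ H₂ : Set P} {d : ℤ} {p : P} {x y : G.bigStar S d}

variable (hG : G.IsShultSpace)
include hG

theorem exists_eq_singleton (hS : G.IsSingular S) (hd : G.dim S = 0) : ∃ p, S = {p} := by
  have h := hG.isHyperplane_of_dim_eq hS isSingular_empty (Set.empty_subset S)
    (by rw [hd, dim_empty]; rfl)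
  obtain ⟨p, hp, -⟩ := Set.exists_of_ssubset h.ssubset
  exact ⟨p, (hG.eq_of_subset_of_dim_le hS (isSingular_singleton p)
    (Set.singleton_subset_iff.2 hp) (by rw [hd, hG.dim_singleton])).symm⟩

theorem isHyperplane_bigStar (hS : G.IsSingular S) (hd : G.dim S = d - 1) (x : G.bigStar S d) :
    G.IsHyperplane S x.1 := by
  obtain ⟨hx, hdx⟩ := hG.hasDim_iff.1 x.2.1
  exact hG.isHyperplane_of_dim_eq hx hS x.2.2 (by omega)

theorem bigStar_eq_of_subset (h : x.1 ⊆ y.1) : x = y := by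
  obtain ⟨hx, hdx⟩ := hG.hasDim_iff.1 x.2.1
  obtain ⟨hy, hdy⟩ := hG.hasDim_iff.1 y.2.1
  exact Subtype.ext (hG.eq_of_subset_of_dim_le hy hx h (by omega))

theorem hasDim_span_union (hS : G.IsSingular S) (hd : G.dim S = d - 1) (hxy : x ≠ y)
    (h : x.1 ⊆ G.perp y.1) : G.HasDim (G.span (x.1 ∪ y.1)) (d + 1) := by
  have hSx := hG.isHyperplane_bigStar hS hd x
  have hSy := hG.isHyperplane_bigStar hS hd y
  obtain ⟨b, hby, hbS⟩ := Set.exists_of_ssubset hSy.ssubset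
  obtain ⟨N, hN, -, hxN, hyN⟩ :=
    hG.exists_isSingular_of_mem_perp hSx hSy hby hbS (subset_perp_comm.1 h hby)
  have hU := hG.isHyperplane_span_union hSx hSy (Subtype.coe_ne_coe.2 hxy) hN hxN hyN
  exact hG.hasDim_iff.2 ⟨hU.isSingular, by rw [hG.dim_eq_add_one hU, (hG.hasDim_iff.1 x.2.1).2]⟩

theorem quotient_collinear_iff (hS : G.IsSingular S) (hd : G.dim S = d - 1) (hxy : x ≠ y) :
    (G.quotient S d).Collinear x y ↔ x.1 ⊆ G.perp y.1 := by
  constructor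
  · rintro ⟨_, ⟨U, hU, -, rfl⟩, hx, hy⟩
    exact hx.trans ((hG.subset_perp (hG.hasDim_iff.1 hU).1).trans (perp_anti hy))
  · intro h
    have hxU : x.1 ⊆ G.span (x.1 ∪ y.1) := Set.subset_union_left.trans (subset_span _)
    exact ⟨_, ⟨_, hG.hasDim_span_union hS hd hxy h, x.2.2.trans hxU, rfl⟩, hxU,
      Set.subset_union_right.trans (subset_span _)⟩

theorem isSubspace_quotient (hV : G.IsSubspace V) :
    (G.quotient S d).IsSubspace {x | x.1 ⊆ V} := by
  rintro _ ⟨U, hU, -, rfl⟩ x (hx : x.1 ⊆ U) y (hy : y.1 ⊆ U) hxy (hxV : x.1 ⊆ V) (hyV : y.1 ⊆ V)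
    z (hz : z.1 ⊆ U)
  obtain ⟨hU, hdU⟩ := hG.hasDim_iff.1 hU
  obtain ⟨a, hay, hax⟩ := Set.not_subset.1 fun h => hxy (hG.bigStar_eq_of_subset h).symm
  have hxU := hG.isHyperplane_of_dim_eq hU (hG.hasDim_iff.1 x.2.1).1 hx
    (by rw [hdU, (hG.hasDim_iff.1 x.2.1).2])
  rw [hxU.eq_span_insert (hy hay) hax] at hz
  exact hz.trans (span_subset hV (Set.insert_subset (hyV hay) hxV))

theorem exists_bigStar_eq_span_insert (hS : G.IsSingular S) (hd : G.dim S = d - 1)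
    (hp : p ∈ G.perp S) (hpS : p ∉ S) : ∃ x : G.bigStar S d, x.1 = G.span (insert p S) :=
  ⟨⟨_, hG.hasDim_iff.2 ⟨hG.isSingular_span_insert hS hp,
    by rw [hG.dim_span_insert hS hp hpS]; omega⟩, subset_span_insert p S⟩, rfl⟩

theorem exists_bigStar_subset (hS : G.IsSingular S) (hd : G.dim S ≤ d) (hV : G.IsSingular V)
    (hSV : S ⊆ V) (hdV : d ≤ G.dim V) : ∃ x : G.bigStar S d, x.1 ⊆ V := by
  obtain ⟨R, hR, hSR, hRV, hdR⟩ := hG.exists_between hV hS hSV hd hdV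
  exact ⟨⟨R, hG.hasDim_iff.2 ⟨hR, hdR⟩, hSR⟩, hRV⟩

theorem mem_of_isHyperplane_of_ne (hS : G.IsSingular S) (hd : G.dim S = d - 1)
    (h₁ : G.IsHyperplane H₁ V) (h₂ : G.IsHyperplane H₂ V) (hS₁ : S ⊆ H₁) (hS₂ : S ⊆ H₂)
    (hne : H₁ ≠ H₂) {T : Set (G.bigStar S d)} (hT : (G.quotient S d).IsSubspace T)
    (hT₁ : ∀ x : G.bigStar S d, x.1 ⊆ H₁ → x ∈ T) (hT₂ : ∀ x : G.bigStar S d, x.1 ⊆ H₂ → x ∈ T)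
    (hx : x.1 ⊆ V) : x ∈ T := by
  by_cases hxH₁ : x.1 ⊆ H₁
  · exact hT₁ x hxH₁
  obtain ⟨q, hq₁, hq₂⟩ := Set.not_subset.1 fun h : H₁ ⊆ H₂ => hne
    ((h₁.eq_or_eq _ h₂.isSingular_left.1 h h₂.subset).resolve_right h₂.ssubset.ne).symm
  obtain ⟨x₁, hx₁⟩ := hG.exists_bigStar_eq_span_insert hS hd
    (perp_anti hS₁ (hG.subset_perp h₁.isSingular_left hq₁)) fun h => hq₂ (hS₂ h)
  have hqx₁ : q ∈ x₁.1 := hx₁ ▸ mem_span_insert q S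
  have hx₁H : x₁.1 ⊆ H₁ := hx₁ ▸ span_subset h₁.isSingular_left.1 (Set.insert_subset hq₁ hS₁)
  have hx₁V := hx₁H.trans h₁.subset
  have hU := hG.hasDim_span_union hS hd (fun h : x = x₁ => hxH₁ (h ▸ hx₁H))
    (hx.trans ((hG.subset_perp h₁.isSingular).trans (perp_anti hx₁V)))
  obtain ⟨hU', hdU⟩ := hG.hasDim_iff.1 hU
  have hle := hG.le_dim_inter_of_isHyperplane h₂ hU'
    (span_subset h₁.isSingular.1 (Set.union_subset hx hx₁V))
  have hxU : x.1 ⊆ G.span (x.1 ∪ x₁.1) := Set.subset_union_left.trans (subset_span _)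
  obtain ⟨x₂, hx₂⟩ := hG.exists_bigStar_subset hS (d := d) (by omega)
    (hU'.inter h₂.isSingular_left.1) (Set.subset_inter (x.2.2.trans hxU) hS₂) (by omega)
  obtain ⟨hx₂U, hx₂H⟩ := Set.subset_inter_iff.1 hx₂
  have hx₁₂ : x₁ ≠ x₂ := fun h => hq₂ (hx₂H (h ▸ hqx₁))
  exact hT _ ⟨_, hU, x.2.2.trans hxU, rfl⟩ x₁ (Set.subset_union_right.trans (subset_span _)) x₂
    hx₂U hx₁₂ (hT₁ x₁ hx₁H) (hT₂ x₂ hx₂H) hxU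

end IsShultSpace

theorem IsShultSpace.exists_grassmannian_eq (hG : G.IsShultSpace) {k : ℤ} {X : Set P}
    (hX : G.IsSingular X) (hd : G.dim X = k) : ∃ Y : G.Grassmannian k, Y.1 = X :=
  ⟨⟨X, hG.hasDim_iff.2 ⟨hX, hd⟩⟩, rfl⟩

section MeetImage

variable {P' : Type*} {G' : PointLineGeometry P'} {n n' k k' : ℕ}

/-- The intersection of the images of all `k`-dimensional singular subspaces containing `A`. It
extends the map `f` to the singular subspaces of dimension less than `k`. -/
def meetImage (f : G.Grassmannian k → G'.Grassmannian k') (A : Set P) : Set P' :=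
  {y | ∀ X : G.Grassmannian k, A ⊆ X.1 → y ∈ (f X).1}

/-- The subspace spanned by the subspaces `meetImage f {p}` for the points `p` of `A`. It extends
the map `f` to the singular subspaces of dimension larger than `k`. -/
def imageSpan (f : G.Grassmannian k → G'.Grassmannian k') (A : Set P) : Set P' :=
  G'.span (⋃ p ∈ A, meetImage f {p})

/-- A map between the Grassmannians of two Shult spaces which does not decrease distances in the
Grassmann graphs and sends stars into stars. -/
structure IsStarEmbedding (G : PointLineGeometry P) (G' : PointLineGeometry P') (n n' k k' : ℕ)
    (f : G.Grassmannian k → G'.Grassmannian k') : Prop where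
  isShultSpace : G.IsShultSpace
  isShultSpace' : G'.IsShultSpace
  hasRank : G.HasRank n
  hasRank' : G'.HasRank n'
  add_three_le : k + 3 ≤ n
  edist_le : ∀ X Y,
    (G.grassmannGraph n k).edist X Y ≤ (G'.grassmannGraph n' k').edist (f X) (f Y)
  star : ∀ 𝒳, G.IsStar n k 𝒳 → ∃ 𝒴, G'.IsStar n' k' 𝒴 ∧ f '' 𝒳 ⊆ 𝒴

variable {f : G.Grassmannian k → G'.Grassmannian k'} {A A₁ A₂ B H S V X Y Z : Set P} {p q : P}

theorem meetImage_mono (h : A ⊆ B) : meetImage f A ⊆ meetImage f B :=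
  fun _ hy X hX => hy X (h.trans hX)

theorem imageSpan_mono (h : A ⊆ B) : imageSpan f A ⊆ imageSpan f B :=
  span_mono (Set.biUnion_subset_biUnion_left h)

theorem meetImage_subset_imageSpan (hp : p ∈ A) : meetImage f {p} ⊆ imageSpan f A :=
  (Set.subset_biUnion_of_mem (u := fun p => meetImage f {p}) hp).trans (subset_span _)

namespace IsStarEmbedding

variable (hf : G.IsStarEmbedding G' n n' k k' f)
include hf

theorem succ_lt : k + 1 < n := by
  have := hf.add_three_le
  omega

theorem injective : Function.Injective f := by
  intro X Y hXY
  have h := hf.edist_le X Y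
  rwa [hXY, SimpleGraph.edist_self, nonpos_iff_eq_zero, SimpleGraph.edist_eq_zero_iff] at h

theorem meetImage_eq (X : G.Grassmannian k) : meetImage f X.1 = (f X).1 := by
  have hG := hf.isShultSpace
  refine Set.Subset.antisymm (fun y hy => hy X subset_rfl) fun y hy Z hXZ => ?_
  have hZX : X = Z := Subtype.ext <| hG.eq_of_subset_of_dim_le (hG.isSingular_grassmannian Z)
    (hG.isSingular_grassmannian X) hXZ (by rw [hG.dim_grassmannian, hG.dim_grassmannian])
  exact hZX ▸ hy

theorem exists_grassmannian (hA : G.IsSingular A) (hd : G.dim A ≤ k) :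
    ∃ X : G.Grassmannian k, A ⊆ X.1 := by
  have hG := hf.isShultSpace
  have := hf.succ_lt
  obtain ⟨U, hU, hAU, hdU⟩ := hG.exists_maximal hf.hasRank hA
  obtain ⟨X, hX, hAX, -, hdX⟩ := hG.exists_between hU hA hAU hd (by omega)
  exact ⟨⟨X, hG.hasDim_iff.2 ⟨hX, hdX⟩⟩, hAX⟩

theorem isSingular_meetImage (hA : G.IsSingular A) (hd : G.dim A ≤ k) :
    G'.IsSingular (meetImage f A) := by
  have hG' := hf.isShultSpace'
  obtain ⟨X, hAX⟩ := hf.exists_grassmannian hA hd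
  refine ⟨fun L hL x hx y hy hxy hxS hyS z hz Y hY => ?_, fun x hx y hy => ?_⟩
  · exact (hG'.isSingular_grassmannian (f Y)).1 L hL x hx y hy hxy (hxS Y hY) (hyS Y hY) hz
  · exact (hG'.isSingular_grassmannian (f X)).2 x (hx X hAX) y (hy X hAX)

theorem exists_star (hV : G.IsSingular V) (hA : G.IsSingular A) (hAV : A ⊆ V)
    (hd : G.dim A = k - 1) : ∃ S U, G'.IsSingular U ∧ G'.dim U = n' - 1 ∧
      ∀ X : G.Grassmannian k, A ⊆ X.1 → X.1 ⊆ V → G'.IsHyperplane S (f X).1 ∧ (f X).1 ⊆ U := by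
  have hG := hf.isShultSpace
  have hG' := hf.isShultSpace'
  obtain ⟨W, hW, hVW, hdW⟩ := hG.exists_maximal hf.hasRank hV
  obtain ⟨_, ⟨S, U, hS, hU, -, rfl⟩, h⟩ := hf.star _ ⟨A, W, hG.hasDim_iff.2 ⟨hA, hd⟩,
    hG.hasDim_iff.2 ⟨hW, hdW⟩, hAV.trans hVW, rfl⟩
  obtain ⟨hS, hdS⟩ := hG'.hasDim_iff.1 hS
  obtain ⟨hU, hdU⟩ := hG'.hasDim_iff.1 hU
  refine ⟨S, U, hU, hdU, fun X hAX hXV => ?_⟩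
  obtain ⟨hSX, hXU⟩ := h ⟨X, ⟨hAX, hXV.trans hVW⟩, rfl⟩
  refine ⟨hG'.isHyperplane_of_dim_eq (hG'.isSingular_grassmannian _) hS hSX ?_, hXU⟩
  rw [hG'.dim_grassmannian, hdS]
  omega

theorem succ_lt' : k' + 1 < n' := by
  have hG := hf.isShultSpace
  have hG' := hf.isShultSpace'
  have := hf.add_three_le
  obtain ⟨V, hV, -, hdV⟩ := hG.exists_maximal hf.hasRank isSingular_empty
  obtain ⟨A, hA, -, hAV, hdA⟩ := hG.exists_between hV isSingular_empty (Set.empty_subset V)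
    (d := k - 1) (by rw [dim_empty]; omega) (by omega)
  obtain ⟨X, Y, hX, hY, hXV, hYV, hXY⟩ := hG.exists_pair_isHyperplane hV hA hAV (by omega)
  obtain ⟨X, rfl⟩ := hG.exists_grassmannian_eq (k := k) hX.isSingular
    (by rw [hG.dim_eq_add_one hX]; omega)
  obtain ⟨Y, rfl⟩ := hG.exists_grassmannian_eq (k := k) hY.isSingular
    (by rw [hG.dim_eq_add_one hY]; omega)
  obtain ⟨S, U, hU, hdU, h⟩ := hf.exists_star hV hA hAV hdA
  by_contra hk'
  have h_eq (Z : G.Grassmannian k) (hAZ : A ⊆ Z.1) (hZV : Z.1 ⊆ V) : (f Z).1 = U :=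
    hG'.eq_of_subset_of_dim_le hU (hG'.isSingular_grassmannian _) (h Z hAZ hZV).2
      (by rw [hG'.dim_grassmannian]; omega)
  have hfXY : (f X).1 = (f Y).1 := (h_eq X hX.subset hXV).trans (h_eq Y hY.subset hYV).symm
  exact hXY (congrArg Subtype.val (hf.injective (Subtype.ext hfXY)))

theorem meetImage_ne (h₁ : G.IsHyperplane B A₁) (h₂ : G.IsHyperplane B A₂) (hne : A₁ ≠ A₂)
    (hd : G.dim A₁ ≤ k) (hdF : G'.dim (meetImage f A₁) = k' - k + G.dim A₁) :
    meetImage f A₁ ≠ meetImage f A₂ := by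
  have hG := hf.isShultSpace
  have hd₁ := hG.dim_eq_add_one h₁
  have hd₂ := hG.dim_eq_add_one h₂
  intro heq
  obtain hdk | hdk := hd.eq_or_lt
  · obtain ⟨X₁, rfl⟩ := hG.exists_grassmannian_eq h₁.isSingular hdk
    obtain ⟨X₂, rfl⟩ := hG.exists_grassmannian_eq (k := k) h₂.isSingular (by omega)
    rw [hf.meetImage_eq, hf.meetImage_eq] at heq
    exact hne (congrArg Subtype.val (hf.injective (Subtype.ext heq)))
  obtain ⟨c, hc⟩ := Int.eq_ofNat_of_zero_le (show 0 ≤ (k : ℤ) - G.dim A₁ by omega)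
  obtain ⟨X₁, X₂, hX₁, hX₂, hlt⟩ := hG.exists_lt_edist hf.hasRank hf.succ_lt (r := c + 1)
    h₁ h₂ hne (by omega) (by push_cast; omega)
  refine ((hf.edist_le X₁ X₂).trans ?_).not_gt hlt
  exact hf.isShultSpace'.edist_le_of_le_dim hf.hasRank' hf.succ_lt'
    (hf.isSingular_meetImage h₁.isSingular hd) (fun y hy => hy X₁ hX₁)
    (fun y hy => (heq ▸ hy : y ∈ meetImage f A₂) X₂ hX₂) (by omega)

theorem isHyperplane_meetImage_of_dim_eq (h : G.IsHyperplane H S) (hS : G.dim S ≤ k)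
    (hFH : G'.dim (meetImage f H) = k' - k + G.dim H)
    (hFS : G'.dim (meetImage f S) = k' - k + G.dim S) :
    G'.IsHyperplane (meetImage f H) (meetImage f S) := by
  have hd := hf.isShultSpace.dim_eq_add_one h
  exact hf.isShultSpace'.isHyperplane_of_dim_eq (hf.isSingular_meetImage h.isSingular hS)
    (hf.isSingular_meetImage h.isSingular_left (by omega)) (meetImage_mono h.subset) (by omega)

theorem exists_isHyperplane_meetImage (hV : G.IsSingular V) (hA : G.IsSingular A) (hAV : A ⊆ V)
    (hd : G.dim A = k - 1) :
    ∃ S, ∀ X, G.IsHyperplane A X → X ⊆ V → G'.IsHyperplane S (meetImage f X) := by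
  have hG := hf.isShultSpace
  obtain ⟨S, U, -, -, h⟩ := hf.exists_star hV hA hAV hd
  refine ⟨S, fun X hX hXV => ?_⟩
  obtain ⟨X, rfl⟩ := hG.exists_grassmannian_eq (k := k) hX.isSingular
    (by rw [hG.dim_eq_add_one hX]; omega)
  rw [hf.meetImage_eq]
  exact (h X hX.subset hXV).1

section Induction

variable (hAk : G.dim A < k) (hD : ∀ B, G.IsSingular B → G.dim A < G.dim B → G.dim B ≤ k →
  G'.dim (meetImage f B) = k' - k + G.dim B)
include hAk hD

theorem isHyperplane_meetImage_inter (hV : G.IsSingular V) (hXV : X ⊆ V) (hYV : Y ⊆ V)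
    (hX : G.IsHyperplane A X) (hY : G.IsHyperplane A Y) (hXY : X ≠ Y) :
    G'.IsHyperplane (meetImage f X ∩ meetImage f Y) (meetImage f X) := by
  have hG := hf.isShultSpace
  have hdX := hG.dim_eq_add_one hX
  have hdY := hG.dim_eq_add_one hY
  have hFX := hD X hX.isSingular (by omega) (by omega)
  have hFXY := hf.meetImage_ne hX hY hXY (by omega) hFX
  obtain hd | hd := (show G.dim X ≤ k by omega).eq_or_lt
  · obtain ⟨S, hS⟩ := hf.exists_isHyperplane_meetImage hV hX.isSingular_left
      (hX.subset.trans hXV) (by omega)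
    rw [(hS X hX hXV).inter_eq_of_ne (hS Y hY hYV) hFXY]
    exact hS X hX hXV
  · have hXJ := hG.isHyperplane_span_union hX hY hXY hV hXV hYV
    have hYJ := hG.isHyperplane_span_union hY hX hXY.symm hV hYV hXV
    rw [Set.union_comm] at hYJ
    have hdJ := hG.dim_eq_add_one hXJ
    have hFJ := hD _ hXJ.isSingular (by omega) (by omega)
    exact hf.isShultSpace'.isHyperplane_inter
      (hf.isHyperplane_meetImage_of_dim_eq hXJ (by omega) hFX hFJ)
      (hf.isHyperplane_meetImage_of_dim_eq hYJ (by omega)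
        (hD Y hY.isSingular (by omega) (by omega)) hFJ) hFXY

theorem meetImage_inter_subset (hV : G.IsSingular V) (hXV : X ⊆ V) (hYV : Y ⊆ V) (hZV : Z ⊆ V)
    (hX : G.IsHyperplane A X) (hY : G.IsHyperplane A Y) (hZ : G.IsHyperplane A Z) (hXY : X ≠ Y)
    (hZXY : ¬ Z ⊆ G.span (X ∪ Y)) : meetImage f X ∩ meetImage f Y ⊆ meetImage f Z := by
  have hG := hf.isShultSpace
  have hdX := hG.dim_eq_add_one hX
  have hdZ := hG.dim_eq_add_one hZ
  obtain hd | hd := (show G.dim X ≤ k by omega).eq_or_lt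
  · obtain ⟨S, hS⟩ := hf.exists_isHyperplane_meetImage hV hX.isSingular_left
      (hX.subset.trans hXV) (by omega)
    have hFXY := hf.meetImage_ne hX hY hXY hd.le (hD X hX.isSingular (by omega) hd.le)
    rw [(hS X hX hXV).inter_eq_of_ne (hS Y hY hYV) hFXY]
    exact (hS Z hZ hZV).subset
  · have hZX : Z ≠ X := fun h => hZXY (h ▸ Set.subset_union_left.trans (subset_span _))
    have hZY : Z ≠ Y := fun h => hZXY (h ▸ Set.subset_union_right.trans (subset_span _))
    have hJX := hG.isHyperplane_span_union hZ hX hZX hV hZV hXV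
    have hJY := hG.isHyperplane_span_union hZ hY hZY hV hZV hYV
    have hdJX := hG.dim_eq_add_one hJX
    have hdJY := hG.dim_eq_add_one hJY
    have hJ : G.span (Z ∪ X) ≠ G.span (Z ∪ Y) := by
      intro hJ
      rw [Set.union_comm Z X] at hJ
      have hYJ : Y ⊆ G.span (X ∪ Z) := hJ ▸ Set.subset_union_right.trans (subset_span _)
      have hXYJ := hG.span_union_eq_of_subset hX hZ hY hZX.symm hXY hV hXV hZV hYJ
      exact hZXY (hXYJ ▸ Set.subset_union_right.trans (subset_span _))
    have hFZ := hD Z hZ.isSingular (by omega) (by omega)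
    have hFJX := hD _ hJX.isSingular (by omega) (by omega)
    have hFJY := hD _ hJY.isSingular (by omega) (by omega)
    rw [← (hf.isHyperplane_meetImage_of_dim_eq hJX (by omega) hFZ hFJX).inter_eq_of_ne
      (hf.isHyperplane_meetImage_of_dim_eq hJY (by omega) hFZ hFJY)
      (hf.meetImage_ne hJX hJY hJ (by omega) hFJX)]
    exact Set.inter_subset_inter (meetImage_mono (Set.subset_union_right.trans (subset_span _)))
      (meetImage_mono (Set.subset_union_right.trans (subset_span _)))

theorem dim_meetImage_of_dim_lt (hA : G.IsSingular A) :
    G'.dim (meetImage f A) = k' - k + G.dim A := by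
  have hG := hf.isShultSpace
  have := hf.add_three_le
  obtain ⟨V, X, Y, hV, hXV, hYV, hX, hY, hXY, hFZ⟩ := hG.exists_inter_subset (F := meetImage f)
    (fun V X Y Z => hf.meetImage_inter_subset hAk hD) hf.hasRank hA (by omega)
  have hFA : meetImage f A = meetImage f X ∩ meetImage f Y := by
    refine (Set.subset_inter (meetImage_mono hX.subset) (meetImage_mono hY.subset)).antisymm ?_
    intro y hy W hAW
    have hAW' : A ⊂ W.1 := hAW.ssubset_of_ne <| by
      rintro rfl
      exact hAk.ne (hG.dim_grassmannian W)
    obtain ⟨Z, hZ, hZW⟩ := hG.exists_isHyperplane_subset (hG.isSingular_grassmannian W) hA hAW'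
    exact hFZ Z hZ hy W hZW
  have hdX := hG.dim_eq_add_one hX
  have hFX := hD X hX.isSingular (by omega) (by omega)
  have hd := hf.isShultSpace'.dim_eq_add_one
    (hf.isHyperplane_meetImage_inter hAk hD hV hXV hYV hX hY hXY)
  rw [hFA]
  omega

end Induction

theorem dim_meetImage (hA : G.IsSingular A) (hd : G.dim A ≤ k) :
    G'.dim (meetImage f A) = k' - k + G.dim A := by
  obtain ⟨m, hm⟩ := Int.eq_ofNat_of_zero_le (sub_nonneg.2 hd)
  induction m using Nat.strong_induction_on generalizing A with
  | _ m ih =>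
    obtain hdk | hdk := hd.eq_or_lt
    · obtain ⟨X, rfl⟩ := hf.isShultSpace.exists_grassmannian_eq hA hdk
      rw [hf.meetImage_eq, hf.isShultSpace'.dim_grassmannian]
      omega
    · exact hf.dim_meetImage_of_dim_lt hdk (fun B hB hAB hBk =>
        ih ((k : ℤ) - G.dim B).toNat (by omega) hB hBk (by omega)) hA

theorem isHyperplane_meetImage (h : G.IsHyperplane H S) (hS : G.dim S ≤ k) :
    G'.IsHyperplane (meetImage f H) (meetImage f S) := by
  have hd := hf.isShultSpace.dim_eq_add_one h
  exact hf.isHyperplane_meetImage_of_dim_eq h hS (hf.dim_meetImage h.isSingular_left (by omega))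
    (hf.dim_meetImage h.isSingular hS)

theorem not_meetImage_subset (hA : G.IsSingular A) (hp : p ∈ G.perp A) (hpA : p ∉ A)
    (hd : G.dim A + 1 ≤ k) : ¬ meetImage f {p} ⊆ meetImage f A := by
  have hG := hf.isShultSpace
  have hG' := hf.isShultSpace'
  refine hG.induction_on_isHyperplane (A := ∅)
    (C := fun A => p ∈ G.perp A → p ∉ A → G.dim A + 1 ≤ k → ¬ meetImage f {p} ⊆ meetImage f A)
    isSingular_empty ?_ ?_ hA (Set.empty_subset A) hp hpA hd
  · intro _ _ hd h
    rw [dim_empty] at hd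
    have hdp := hG.dim_singleton p
    have hle := hG'.dim_mono (hf.isSingular_meetImage isSingular_empty (by rw [dim_empty]; omega))
      (hf.isSingular_meetImage (isSingular_singleton p) (by omega)) h
    rw [hf.dim_meetImage (isSingular_singleton p) (by omega),
      hf.dim_meetImage isSingular_empty (by rw [dim_empty]; omega), dim_empty] at hle
    omega
  · intro H S hHS _ ih hpS hpS' hd h
    have hdS := hG.dim_eq_add_one hHS
    have hpH : p ∈ G.perp H := perp_anti hHS.subset hpS
    have hpH' : p ∉ H := fun h => hpS' (hHS.subset h)
    obtain ⟨q, hq, hqH⟩ := Set.not_subset.1 (ih hpH hpH' (by omega))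
    have hHT := hG.isHyperplane_span_insert hHS.isSingular_left hpH hpH'
    have hdT := hG.dim_eq_add_one hHT
    have hpT : p ∈ G.span (insert p H) := mem_span_insert p H
    -- Both images are spanned by `meetImage f H` and the point `q` of `meetImage f {p}`.
    refine hf.meetImage_ne hHS hHT (fun e => hpS' (e ▸ hpT)) (by omega)
      (hf.dim_meetImage hHS.isSingular (by omega)) ?_
    rw [(hf.isHyperplane_meetImage hHS (by omega)).eq_span_insert (h hq) hqH,
      (hf.isHyperplane_meetImage hHT (by omega)).eq_span_insert
        (meetImage_mono (Set.singleton_subset_iff.2 hpT) hq) hqH]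

theorem meetImage_subset_perp (hpq : G.Collinear p q) :
    meetImage f {p} ⊆ G'.perp (meetImage f {q}) := by
  have hG := hf.isShultSpace
  have := hf.succ_lt
  obtain ⟨U, hU, hpU, hdU⟩ := hG.exists_maximal hf.hasRank
    (hG.isSingular_span_insert (isSingular_singleton q) (mem_perp_singleton.2 hpq))
  obtain ⟨A, hA, -, hAU, hdA⟩ := hG.exists_between hU isSingular_empty (Set.empty_subset U)
    (d := k - 1) (by rw [dim_empty]; omega) (by omega)
  obtain ⟨S, V, hV, -, h⟩ := hf.exists_star hU hA hAU hdA
  have h_subset {x : P} (hx : x ∈ U) : meetImage f {x} ⊆ V := by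
    have hxA := hG.subset_perp hU hx
    have hx' := hG.isSingular_span_insert hA (perp_anti hAU hxA)
    obtain ⟨X, hX, hxX, hXU, hdX⟩ := hG.exists_between hU hx'
      (span_subset hU.1 (Set.insert_subset hx hAU)) (d := k)
      (by have := hG.dim_span_insert_le hA (perp_anti hAU hxA); omega) (by omega)
    obtain ⟨X, rfl⟩ := hG.exists_grassmannian_eq hX hdX
    exact fun y hy => (h X ((subset_span_insert x A).trans hxX) hXU).2
      (hy X (Set.singleton_subset_iff.2 (hxX (mem_span_insert x A))))
  exact (h_subset (hpU (mem_span_insert p _))).trans <| (hf.isShultSpace'.subset_perp hV).trans <|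
    perp_anti (h_subset (hpU (subset_span_insert p _ rfl)))

theorem collinear_of_meetImage_subset_perp_of_isHyperplane (hX : G.IsHyperplane B X)
    (hY : G.IsHyperplane B Y) (hd : G.dim B + 1 = k) (hpX : p ∈ X) (hpB : p ∉ B) (hqY : q ∈ Y)
    (hqB : q ∉ B) (h : meetImage f {p} ⊆ G'.perp (meetImage f {q})) : G.Collinear p q := by
  have hG := hf.isShultSpace
  have hG' := hf.isShultSpace'
  obtain ⟨a, ha, haB⟩ := Set.not_subset.1 <| hf.not_meetImage_subset hX.isSingular_left
    (perp_anti hX.subset (hG.subset_perp hX.isSingular hpX)) hpB hd.le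
  obtain ⟨b, hb, hbB⟩ := Set.not_subset.1 <| hf.not_meetImage_subset hX.isSingular_left
    (perp_anti hY.subset (hG.subset_perp hY.isSingular hqY)) hqB hd.le
  have hFX := hf.isHyperplane_meetImage hX (by rw [hG.dim_eq_add_one hX, hd])
  have hFY := hf.isHyperplane_meetImage hY (by rw [hG.dim_eq_add_one hY, hd])
  have haX := meetImage_mono (Set.singleton_subset_iff.2 hpX) ha
  have hbY := meetImage_mono (Set.singleton_subset_iff.2 hqY) hb
  have hbX : b ∈ G'.perp (meetImage f X) := by
    rw [hG'.perp_eq_inter_of_isHyperplane hFX haX haB]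
    exact ⟨perp_anti hFY.subset (hG'.subset_perp hFY.isSingular hbY),
      mem_perp_singleton.2 (h ha b hb).symm⟩
  obtain ⟨N, hN, hdN, hXN, hYN⟩ := hG'.exists_isSingular_of_mem_perp hFX hFY hbY hbB hbX
  obtain ⟨X, rfl⟩ := hG.exists_grassmannian_eq hX.isSingular ((hG.dim_eq_add_one hX).trans hd)
  obtain ⟨Y, rfl⟩ := hG.exists_grassmannian_eq hY.isSingular ((hG.dim_eq_add_one hY).trans hd)
  rw [hf.meetImage_eq] at hXN hYN hdN
  rw [hG'.dim_grassmannian] at hdN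
  obtain ⟨U, hU, -, hXU, hYU⟩ := (hG.edist_le_one_iff hf.hasRank hf.succ_lt).1 <|
    (hf.edist_le X Y).trans <|
      (hG'.edist_le_one_iff hf.hasRank' hf.succ_lt').2 ⟨N, hN, hdN, hXN, hYN⟩
  exact hG.subset_perp hU (hXU hpX) q (hYU hqY)

theorem collinear_iff : G.Collinear p q ↔ meetImage f {p} ⊆ G'.perp (meetImage f {q}) := by
  have hG := hf.isShultSpace
  have := hf.succ_lt
  refine ⟨hf.meetImage_subset_perp, fun h => ?_⟩
  by_contra hpq
  obtain ⟨U, hU, hpU, hdU⟩ := hG.exists_maximal hf.hasRank (isSingular_singleton p)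
  rw [Set.singleton_subset_iff] at hpU
  have hle := hG.le_dim_inter_perp_singleton hU q
  obtain ⟨B, hB, -, hBU, hdB⟩ := hG.exists_between (hG.isSingular_inter_perp hU {q})
    isSingular_empty (Set.empty_subset _) (d := k - 1) (by rw [dim_empty]; omega) (by omega)
  obtain ⟨hBU, hBq⟩ := Set.subset_inter_iff.1 hBU
  have hpB : p ∉ B := fun hp => hpq (mem_perp_singleton.1 (hBq hp))
  have hqB : q ∉ B := fun hq => hpq (hG.subset_perp hU hpU q (hBU hq))
  have hX := hG.isHyperplane_span_insert hB (perp_anti hBU (hG.subset_perp hU hpU)) hpB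
  have hY := hG.isHyperplane_span_insert hB (subset_perp_singleton.1 hBq) hqB
  exact hpq <| hf.collinear_of_meetImage_subset_perp_of_isHyperplane hX hY (by omega)
    (mem_span_insert p B) hpB (mem_span_insert q B) hqB h

theorem meetImage_singleton_injective : Function.Injective fun p => meetImage f {p} := by
  intro p q (hpq : meetImage f {p} = meetImage f {q})
  by_contra hne
  obtain ⟨z, hzq, hzp⟩ := hf.isShultSpace.exists_mem_perp_not_collinear
    (isSingular_singleton q) (w := p) hne
  rw [hf.collinear_iff, hpq, ← hf.collinear_iff] at hzp
  exact hzp (mem_perp_singleton.1 hzq)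

theorem meetImage_subset_perp_imageSpan (hp : p ∈ G.perp A) :
    meetImage f {p} ⊆ G'.perp (imageSpan f A) := by
  rw [imageSpan, hf.isShultSpace'.perp_span, subset_perp_comm]
  exact Set.iUnion₂_subset fun q hq => hf.meetImage_subset_perp (hp q hq).symm

theorem isSingular_imageSpan (hA : G.IsSingular A) : G'.IsSingular (imageSpan f A) := by
  refine hf.isShultSpace'.isSingular_span (Set.iUnion₂_subset fun p hp => ?_)
  exact (hf.meetImage_subset_perp_imageSpan (hf.isShultSpace.subset_perp hA hp)).trans
    (perp_anti (subset_span _))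

theorem le_dim_imageSpan (hS : G.IsSingular S) (hp : p ∈ S) :
    (k' : ℤ) - k + G.dim S ≤ G'.dim (imageSpan f S) := by
  have hG := hf.isShultSpace
  have hG' := hf.isShultSpace'
  refine hG.induction_on_isHyperplane (A := {p})
    (C := fun S => (k' : ℤ) - k + G.dim S ≤ G'.dim (imageSpan f S))
    (isSingular_singleton p) ?_ (fun H S hHS _ ih => ?_) hS (Set.singleton_subset_iff.2 hp)
  · have hdp : G.dim {p} ≤ k := by rw [hG.dim_singleton]; omega
    rw [← hf.dim_meetImage (isSingular_singleton p) hdp]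
    exact hG'.dim_mono (hf.isSingular_imageSpan (isSingular_singleton p))
      (hf.isSingular_meetImage (isSingular_singleton p) hdp) (meetImage_subset_imageSpan rfl)
  · obtain ⟨q, hqS, hqH⟩ := Set.exists_of_ssubset hHS.ssubset
    obtain ⟨z, hzH, hzq⟩ := hG.exists_mem_perp_not_collinear hHS.isSingular_left hqH
    have h_not_subset : ¬ imageSpan f S ⊆ imageSpan f H := fun h => hzq <| hf.collinear_iff.2 <|
      (hf.meetImage_subset_perp_imageSpan hzH).trans <|
        perp_anti ((meetImage_subset_imageSpan hqS).trans h)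
    have hlt := hG'.dim_lt_of_ssubset (hf.isSingular_imageSpan hHS.isSingular)
      (hf.isSingular_imageSpan hHS.isSingular_left) ⟨imageSpan_mono hHS.subset, h_not_subset⟩
    have hdS := hG.dim_eq_add_one hHS
    omega

theorem sub_le_sub : (n : ℤ) - k ≤ n' - k' := by
  have := hf.succ_lt
  obtain ⟨U, hU, -, hdU⟩ := hf.isShultSpace.exists_maximal hf.hasRank isSingular_empty
  obtain ⟨p, hp⟩ : U.Nonempty := by
    by_contra! h
    rw [h, dim_empty] at hdU
    omega
  have h_le := hf.le_dim_imageSpan hU hp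
  have h_le' := hf.isShultSpace'.dim_le hf.hasRank' (hf.isSingular_imageSpan hU)
  omega

theorem isSingular_meetImage_singleton (p : P) : G'.IsSingular (meetImage f {p}) :=
  hf.isSingular_meetImage (isSingular_singleton p) (by rw [hf.isShultSpace.dim_singleton]; omega)

theorem isSingular_meetImage_empty : G'.IsSingular (meetImage f ∅) :=
  hf.isSingular_meetImage isSingular_empty (by rw [dim_empty]; omega)

theorem dim_meetImage_empty : G'.dim (meetImage f ∅) = k' - k - 1 := by
  rw [hf.dim_meetImage isSingular_empty (by rw [dim_empty]; omega), dim_empty]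
  omega

theorem hasDim_meetImage_singleton (p : P) : G'.HasDim (meetImage f {p}) (k' - k) := by
  refine hf.isShultSpace'.hasDim_iff.2 ⟨hf.isSingular_meetImage_singleton p, ?_⟩
  rw [hf.dim_meetImage (isSingular_singleton p) (by rw [hf.isShultSpace.dim_singleton]; omega),
    hf.isShultSpace.dim_singleton, add_zero]

/-- The map which `f` induces from the points of `G` to the points of the quotient of `G'` by
`meetImage f ∅`. -/
def pointMap (p : P) : G'.bigStar (meetImage f ∅) (k' - k) :=
  ⟨meetImage f {p}, hf.hasDim_meetImage_singleton p, meetImage_mono (Set.empty_subset _)⟩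

theorem isCollinearityPreservingInjection_pointMap :
    G.IsCollinearityPreservingInjection (G'.quotient (meetImage f ∅) (k' - k)) hf.pointMap := by
  have h_inj : Function.Injective hf.pointMap := fun p q h =>
    hf.meetImage_singleton_injective (congrArg Subtype.val h)
  refine ⟨h_inj, fun p q hpq => ?_⟩
  rw [hf.isShultSpace'.quotient_collinear_iff hf.isSingular_meetImage_empty hf.dim_meetImage_empty
    (h_inj.ne hpq)]
  exact hf.collinear_iff

theorem mem_of_subset_meetImage {T : Set (G'.bigStar (meetImage f ∅) (k' - k))}
    (hT : (G'.quotient (meetImage f ∅) (k' - k)).IsSubspace T) (hY : G.IsSingular Y) {m : ℕ}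
    (hd : G.dim Y = m) (hm : m ≤ k) (hYT : ∀ p ∈ Y, hf.pointMap p ∈ T)
    {x : G'.bigStar (meetImage f ∅) (k' - k)} (hx : x.1 ⊆ meetImage f Y) : x ∈ T := by
  have hG := hf.isShultSpace
  have hG' := hf.isShultSpace'
  induction m generalizing Y x with
  | zero =>
    obtain ⟨p, rfl⟩ := hG.exists_eq_singleton hY hd
    rw [hG'.bigStar_eq_of_subset (y := hf.pointMap p) hx]
    exact hYT p rfl
  | succ m ih =>
    push_cast at hd
    obtain ⟨H, K, hH, hK, hHK⟩ := hG.exists_isHyperplane_ne hY (by omega)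
    have hdH := hG.dim_eq_add_one hH
    have hdK := hG.dim_eq_add_one hK
    have h_inter_left := hG.isHyperplane_inter hH hK hHK
    have h_inter_right := hG.isHyperplane_inter hK hH hHK.symm
    rw [Set.inter_comm] at h_inter_right
    have hne := hf.meetImage_ne h_inter_left h_inter_right hHK (by omega)
      (hf.dim_meetImage hH.isSingular_left (by omega))
    exact hG'.mem_of_isHyperplane_of_ne hf.isSingular_meetImage_empty hf.dim_meetImage_empty
      (hf.isHyperplane_meetImage hH (by omega)) (hf.isHyperplane_meetImage hK (by omega))
      (meetImage_mono (Set.empty_subset H)) (meetImage_mono (Set.empty_subset K)) hne hT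
      (fun x => ih hH.isSingular_left (by omega) (by omega) fun p hp => hYT p (hH.subset hp))
      (fun x => ih hK.isSingular_left (by omega) (by omega) fun p hp => hYT p (hK.subset hp)) hx

theorem span_image_pointMap (X : G.Grassmannian k) :
    (G'.quotient (meetImage f ∅) (k' - k)).span (hf.pointMap '' X.1) = {x | x.1 ⊆ (f X).1} := by
  have hG' := hf.isShultSpace'
  refine Set.Subset.antisymm (span_subset (hG'.isSubspace_quotient
    (hG'.isSingular_grassmannian (f X)).1) ?_) fun x (hx : x.1 ⊆ (f X).1) => ?_
  · rintro _ ⟨p, hp, rfl⟩ y hy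
    exact hy X (Set.singleton_subset_iff.2 hp)
  · exact hf.mem_of_subset_meetImage (isSubspace_span _)
      (hf.isShultSpace.isSingular_grassmannian X) (hf.isShultSpace.dim_grassmannian X) le_rfl
      (fun _ hp => subset_span _ (Set.mem_image_of_mem _ hp))
      (hx.trans (hf.meetImage_eq X).superset)

end IsStarEmbedding

end MeetImage

end PointLineGeometry

theorem proposition2_general {P P' : Type*} (G : PointLineGeometry P) (G' : PointLineGeometry P')
    (n n' k k' : ℕ) (hG : G.IsShultSpace) (hn : G.HasRank n) (hG' : G'.IsShultSpace)
    (hn' : G'.HasRank n') (hkn : k + 3 ≤ n) (f : G.Grassmannian k → G'.Grassmannian k')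
    (hf : ∀ X Y, (G.grassmannGraph n k).edist X Y ≤ (G'.grassmannGraph n' k').edist (f X) (f Y))
    (hstar : ∀ 𝒳, G.IsStar n k 𝒳 → ∃ 𝒴, G'.IsStar n' k' 𝒴 ∧ f '' 𝒳 ⊆ 𝒴) :
    (n : ℤ) - k ≤ (n' : ℤ) - k' ∧
    ∃ S : Set P', G'.HasDim S ((k' : ℤ) - k - 1) ∧
      (∀ X, (f X).1 ∈ G'.bigStar S k') ∧
      ∃ g : P → G'.bigStar S ((k' : ℤ) - k),
        G.IsCollinearityPreservingInjection (G'.quotient S ((k' : ℤ) - k)) g ∧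
        ∀ X, (G'.quotient S ((k' : ℤ) - k)).span (g '' X.1) = {x | x.1 ⊆ (f X).1} := by
  have hf' : G.IsStarEmbedding G' n n' k k' f := ⟨hG, hG', hn, hn', hkn, hf, hstar⟩
  exact ⟨hf'.sub_le_sub, _,
    hG'.hasDim_iff.2 ⟨hf'.isSingular_meetImage_empty, hf'.dim_meetImage_empty⟩,
    fun X => ⟨(f X).2, fun _ hy => hy X (Set.empty_subset _)⟩, hf'.pointMap,
    hf'.isCollinearityPreservingInjection_pointMap, hf'.span_image_pointMap⟩

/- In the conclusion, `G'.quotient S (k' - k)` is the quotient polar space of `G'` by the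
`(k' - k - 1)`-dimensional subspace `S`. A `k`-dimensional singular subspace of it is the set of
all its points contained in some `k'`-dimensional singular subspace `V ⊇ S` of `G'`, with which it
is identified; so the last line says that `f` sends `X` to the span of `g(X)`. -/
theorem proposition2 {P P' : Type*} (G : PointLineGeometry P) (G' : PointLineGeometry P')
    (n n' k k' : ℕ)
    (hG : G.IsPolarSpace ∨ G.IsThinPolarSpace) (hn : G.HasRank n)
    (hG' : G'.IsPolarSpace) (hn' : G'.HasRank n')
    (hk : 1 ≤ k) (hkn : k + 3 ≤ n) (hk' : k' + 1 ≤ n')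
    (f : G.grassmannGraph n k ↪g G'.grassmannGraph n' k')
    (hf : ∀ X Y, (G'.grassmannGraph n' k').edist (f X) (f Y) = (G.grassmannGraph n k).edist X Y)
    (hstar : ∀ 𝒳, G.IsStar n k 𝒳 → ∃ 𝒴, G'.IsStar n' k' 𝒴 ∧ f '' 𝒳 ⊆ 𝒴) :
    (n : ℤ) - k ≤ (n' : ℤ) - k' ∧
    ∃ S : Set P', G'.HasDim S ((k' : ℤ) - k - 1) ∧
      (∀ X, (f X).1 ∈ G'.bigStar S k') ∧
      ∃ g : P → G'.bigStar S ((k' : ℤ) - k),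
        G.IsCollinearityPreservingInjection (G'.quotient S ((k' : ℤ) - k)) g ∧
        ∀ X, (G'.quotient S ((k' : ℤ) - k)).span (g '' X.1) = {x | x.1 ⊆ (f X).1} := by
  exact proposition2_general G G' n n' k k'
    (hG.elim (·.isShultSpace) fun h => h.isShultSpace hn (by omega)) hn hG'.isShultSpace hn' hkn f
    (fun X Y => (hf X Y).ge) hstar
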